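/- Let $d\ge 1$, $c>0$, $\Omega>0$, $g\in\mathbb{R}$, and let $\rho\in L^\infty(\mathbb{R}^d)$ be real-valued, nonnegative and compactly supported. Let $(-\Delta)^{1/2}$ be the operator on $L^2(\mathbb{R}^d)=L^2(\mathbb{R}^d;\mathbb{C})$ with domain $H^1(\mathbb{R}^d)$ that acts on the Fourier side as multiplication by $|\mathbf{k}|$, where $\hat f(\mathbf{k})=\int_{\mathbb{R}^d}e^{-i\mathbf{k}\cdot\mathbf{x}}f(\mathbf{x})\,d\mathbf{x}$. Let $H$ be the operator on $L^2(\mathbb{R}^d)\times L^2(\mathbb{R}^d)$ with domain $H^1(\mathbb{R}^d)\times L^2(\mathbb{R}^d)$ given by $$H=\begin{pmatrix}c(-\Delta)^{1/2} & g\sqrt{\rho}\\ g\sqrt{\rho} & \Omega\end{pmatrix},$$ and for $\omega<0$ let $$K_\omega[\rho]=\frac{g^2}{\Omega+|\omega|}\,\rho^{1/2}\left(c(-\Delta)^{1/2}+|\omega|\right)^{-1}\rho^{1/2}$$ as a bounded operator on $L^2(\mathbb{R}^d)$. Then, for every $\omega<0$, the operator $K_\omega[\rho]$ is self-adjoint and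 compact, the number of its eigenvalues in $[1,\infty)$ is finite, and the number of eigenvalues of $H$ in $(-\infty,\omega]$ is equal to the number of eigenvalues of $K_\omega[\rho]$ in $[1,\infty)$. Eigenvalues are counted with multiplicity, the (complex) dimension of the eigenspace. -/

import Mathlib

open MeasureTheory
open scoped ENNReal

noncomputable section

namespace BirmanSchwinger

/-- The complex Hilbert space `L²(ℝᵈ)`. -/
abbrev L2 (d : ℕ) : Type :=
  Lp ℂ 2 (volume : Measure (EuclideanSpace ℝ (Fin d)))

/-- The standing assumptions on the density `ρ`: it is (a.e.) nonnegative, it vanishes (a.e.)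
outside a compact set, and it is (measurable and) essentially bounded. -/
structure IsDensity {d : ℕ} (ρ : EuclideanSpace ℝ (Fin d) → ℝ) : Prop where
  nonneg : ∀ᵐ x, 0 ≤ ρ x
  compactSupport : ∃ S : Set (EuclideanSpace ℝ (Fin d)), IsCompact S ∧ ∀ᵐ x, x ∉ S → ρ x = 0
  essBounded : MemLp ρ ∞ volume

/-- The bounded operator on `L²(ℝᵈ)` of multiplication by an essentially bounded function. -/
def mulOp {d : ℕ} (m : EuclideanSpace ℝ (Fin d) → ℂ) (hm : MemLp m ∞ volume) :
    L2 d →L[ℂ] L2 d :=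
  (ContinuousLinearMap.mul ℂ ℂ).holderL volume ∞ 2 2 (hm.toLp m)

theorem mulOp_coeFn {d : ℕ} (m : EuclideanSpace ℝ (Fin d) → ℂ) (hm : MemLp m ∞ volume)
    (f : L2 d) : mulOp m hm f =ᵐ[volume] fun x ↦ m x * f x := by
  have h := (ContinuousLinearMap.mul ℂ ℂ).coeFn_holder (r := 2) (hm.toLp m) f
  filter_upwards [h, hm.coeFn_toLp] with x hx hx'
  change ((ContinuousLinearMap.mul ℂ ℂ).holder 2 (hm.toLp m) f) x = _
  rw [hx, hx']
  rfl

/-- The square root of a density is essentially bounded. -/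
theorem IsDensity.memLp_sqrt {d : ℕ} {ρ : EuclideanSpace ℝ (Fin d) → ℝ} (hρ : IsDensity ρ) :
    MemLp (fun x ↦ ((√(ρ x) : ℝ) : ℂ)) ∞ volume := by
  have h := hρ.essBounded
  have hC : ∀ᵐ x, ‖ρ x‖ ≤ (eLpNormEssSup ρ volume).toReal := by
    have hlt : eLpNormEssSup ρ volume ≠ ∞ := by
      simpa using h.2.ne
    filter_upwards [enorm_ae_le_eLpNormEssSup ρ volume] with x hx
    rw [← toReal_enorm]
    exact ENNReal.toReal_mono hlt hx
  refine memLp_top_of_bound (Complex.continuous_ofReal.comp_aestronglyMeasurable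
    (Real.continuous_sqrt.comp_aestronglyMeasurable h.1)) (√(eLpNormEssSup ρ volume).toReal) ?_
  filter_upwards [hC] with x hx
  rw [Complex.norm_real, Real.norm_of_nonneg (Real.sqrt_nonneg _)]
  exact Real.sqrt_le_sqrt ((Real.le_norm_self _).trans hx)

/-- Multiplication by `√ρ`. -/
def mulSqrt {d : ℕ} {ρ : EuclideanSpace ℝ (Fin d) → ℝ} (hρ : IsDensity ρ) : L2 d →L[ℂ] L2 d :=
  mulOp (fun x ↦ ((√(ρ x) : ℝ) : ℂ)) hρ.memLp_sqrt

/-- The symbol of `(-Δ)^{1/2}`. Mathlib's Fourier transform is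
`𝓕 f ξ = ∫ exp(-2πi x·ξ) f x dx`, so that `-Δ` has the symbol `(2π|ξ|)²`. -/
def symbol {d : ℕ} (ξ : EuclideanSpace ℝ (Fin d)) : ℂ := ((2 * Real.pi * ‖ξ‖ : ℝ) : ℂ)

/-- The subspace `{f ∈ L² : m f ∈ L²}`. -/
def mulDomain {d : ℕ} (m : EuclideanSpace ℝ (Fin d) → ℂ) : Submodule ℂ (L2 d) where
  carrier := {f | MemLp (fun ξ ↦ m ξ * f ξ) 2 volume}
  add_mem' := fun {f g} hf hg ↦ by
    refine (MemLp.add hf hg).ae_eq ?_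
    filter_upwards [Lp.coeFn_add f g] with ξ h
    rw [h, Pi.add_apply, Pi.add_apply, mul_add]
  zero_mem' := by
    refine (MemLp.zero (ε := ℂ)).ae_eq ?_
    filter_upwards [Lp.coeFn_zero ℂ 2 (volume : Measure (EuclideanSpace ℝ (Fin d)))] with ξ h
    rw [h, Pi.zero_apply, mul_zero]
  smul_mem' := fun a f hf ↦ by
    refine (MemLp.const_smul hf a).ae_eq ?_
    filter_upwards [Lp.coeFn_smul a f] with ξ h
    rw [h, Pi.smul_apply, Pi.smul_apply, smul_eq_mul, smul_eq_mul, mul_left_comm]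

/-- The function `m f ∈ L²` for `f` in `mulDomain m`. -/
def mulFun {d : ℕ} (m : EuclideanSpace ℝ (Fin d) → ℂ) (f : mulDomain m) : L2 d :=
  MemLp.toLp (fun ξ ↦ m ξ * f.1 ξ) f.2

theorem mulFun_coeFn {d : ℕ} (m : EuclideanSpace ℝ (Fin d) → ℂ) (f : mulDomain m) :
    mulFun m f =ᵐ[volume] fun ξ ↦ m ξ * f.1 ξ :=
  MemLp.coeFn_toLp f.2

theorem mulFun_add {d : ℕ} (m : EuclideanSpace ℝ (Fin d) → ℂ) (f g : mulDomain m) :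
    mulFun m (f + g) = mulFun m f + mulFun m g := by
  apply Lp.ext
  filter_upwards [mulFun_coeFn m f, mulFun_coeFn m g, mulFun_coeFn m (f + g),
    Lp.coeFn_add f.1 g.1, Lp.coeFn_add (mulFun m f) (mulFun m g)] with ξ h1 h2 h3 h4 h5
  rw [h3, h5, Pi.add_apply, h1, h2, Submodule.coe_add, h4, Pi.add_apply, mul_add]

theorem mulFun_smul {d : ℕ} (m : EuclideanSpace ℝ (Fin d) → ℂ) (a : ℂ) (f : mulDomain m) :
    mulFun m (a • f) = a • mulFun m f := by
  apply Lp.ext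
  filter_upwards [mulFun_coeFn m f, mulFun_coeFn m (a • f),
    Lp.coeFn_smul a f.1, Lp.coeFn_smul a (mulFun m f)] with ξ h1 h3 h4 h5
  rw [h3, h5, Pi.smul_apply, h1, Submodule.coe_smul, h4, Pi.smul_apply, smul_eq_mul,
    smul_eq_mul, mul_left_comm]

/-- The unbounded operator in `L²(ℝᵈ)` of multiplication by `m`, with its maximal domain
`{f ∈ L² : m f ∈ L²}`. -/
def mulPMap {d : ℕ} (m : EuclideanSpace ℝ (Fin d) → ℂ) : L2 d →ₗ.[ℂ] L2 d where
  domain := mulDomain m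
  toFun :=
    { toFun := mulFun m
      map_add' := mulFun_add m
      map_smul' := mulFun_smul m }

theorem mulPMap_coeFn {d : ℕ} (m : EuclideanSpace ℝ (Fin d) → ℂ) (f : (mulPMap m).domain) :
    mulPMap m f =ᵐ[volume] fun ξ ↦ m ξ * f.1 ξ :=
  MemLp.coeFn_toLp f.2

/-- The Fourier transform as a unitary operator on `L²(ℝᵈ)`. -/
abbrev fourierL2 (d : ℕ) : L2 d ≃ₗᵢ[ℂ] L2 d :=
  Lp.fourierTransformₗᵢ (EuclideanSpace ℝ (Fin d)) ℂ

/-- The operator `(-Δ)^{1/2}` in `L²(ℝᵈ)` with domain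
`H¹(ℝᵈ) = {f ∈ L² : |ξ| 𝓕 f(ξ) ∈ L²}`, acting as `f ↦ 𝓕⁻¹ (2π|ξ| 𝓕 f)`. -/
def sqrtLaplacian (d : ℕ) : L2 d →ₗ.[ℂ] L2 d where
  domain := (mulPMap symbol).domain.comap (fourierL2 d).toLinearEquiv.toLinearMap
  toFun :=
    { toFun := fun f ↦ (fourierL2 d).symm (mulPMap symbol ⟨fourierL2 d f.1, f.2⟩)
      map_add' := fun f g ↦ by
        rw [← map_add, ← LinearPMap.map_add]
        congr 2
        exact Subtype.ext (map_add (fourierL2 d) f.1 g.1)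
      map_smul' := fun a f ↦ by
        rw [RingHom.id_apply, ← map_smul, ← LinearPMap.map_smul]
        congr 2
        exact Subtype.ext (map_smul (fourierL2 d) a f.1) }

theorem memLp_resolventSymbol (d : ℕ) {c κ : ℝ} (hc : 0 < c) (hκ : 0 < κ) :
    MemLp (fun ξ : EuclideanSpace ℝ (Fin d) ↦ ((c : ℂ) * symbol ξ + (κ : ℂ))⁻¹) ∞ volume := by
  have e : (fun ξ : EuclideanSpace ℝ (Fin d) ↦ ((c : ℂ) * symbol ξ + (κ : ℂ))⁻¹) =
      fun ξ ↦ (((c * (2 * Real.pi * ‖ξ‖) + κ)⁻¹ : ℝ) : ℂ) := by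
    funext ξ; simp [symbol]
  rw [e]
  refine memLp_top_of_bound (Measurable.aestronglyMeasurable (by fun_prop)) κ⁻¹ ?_
  refine Filter.Eventually.of_forall fun ξ ↦ ?_
  have h0 : 0 ≤ c * (2 * Real.pi * ‖ξ‖) := by positivity
  rw [Complex.norm_real, Real.norm_of_nonneg (by positivity)]
  exact inv_anti₀ hκ (by linarith)

/-- The bounded operator `(c(-Δ)^{1/2} + κ)⁻¹` on `L²(ℝᵈ)`, for `c, κ > 0`, as the Fourier
multiplier with symbol `(2πc|ξ| + κ)⁻¹`; see `resolvent_eq_iff`. -/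
def resolvent (d : ℕ) {c κ : ℝ} (hc : 0 < c) (hκ : 0 < κ) : L2 d →L[ℂ] L2 d :=
  (fourierL2 d).symm.toContinuousLinearEquiv.toContinuousLinearMap ∘L
    mulOp _ (memLp_resolventSymbol d hc hκ) ∘L
    (fourierL2 d).toContinuousLinearEquiv.toContinuousLinearMap

theorem resolvent_apply (d : ℕ) {c κ : ℝ} (hc : 0 < c) (hκ : 0 < κ) (f : L2 d) :
    resolvent d hc hκ f =
      (fourierL2 d).symm (mulOp _ (memLp_resolventSymbol d hc hκ) (fourierL2 d f)) := rfl

theorem mulOp_resolventSymbol_eq_iff (d : ℕ) {c κ : ℝ} (hc : 0 < c) (hκ : 0 < κ) (f u : L2 d) :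
    mulOp _ (memLp_resolventSymbol d hc hκ) f = u ↔ ∃ hu : u ∈ (mulPMap symbol).domain,
      (c : ℂ) • mulPMap symbol ⟨u, hu⟩ + (κ : ℂ) • u = f := by
  have hne : ∀ ξ : EuclideanSpace ℝ (Fin d), (c : ℂ) * symbol ξ + (κ : ℂ) ≠ 0 := fun ξ ↦ by
    have : 0 < c * (2 * Real.pi * ‖ξ‖) + κ := by positivity
    simpa [symbol] using (Complex.ofReal_ne_zero.2 this.ne')
  have hc' : (c : ℂ) ≠ 0 := Complex.ofReal_ne_zero.2 hc.ne'
  have hm := mulOp_coeFn _ (memLp_resolventSymbol d hc hκ) f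
  constructor
  · intro h
    rw [h] at hm
    have hu : u ∈ (mulPMap symbol).domain := by
      change MemLp (fun ξ ↦ symbol ξ * u ξ) 2 volume
      refine (((Lp.memLp f).sub ((Lp.memLp u).const_smul (κ : ℂ))).const_smul
        ((c : ℂ)⁻¹)).ae_eq ?_
      filter_upwards [hm] with ξ h
      simp only [Pi.smul_apply, Pi.sub_apply, smul_eq_mul, h]
      field_simp [hne ξ]
      ring
    refine ⟨hu, Lp.ext ?_⟩
    filter_upwards [hm, mulPMap_coeFn symbol ⟨u, hu⟩,
      Lp.coeFn_add ((c : ℂ) • mulPMap symbol ⟨u, hu⟩) ((κ : ℂ) • u),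
      Lp.coeFn_smul (c : ℂ) (mulPMap symbol ⟨u, hu⟩), Lp.coeFn_smul (κ : ℂ) u]
      with ξ h1 h2 h3 h4 h5
    rw [h3, Pi.add_apply, h4, h5, Pi.smul_apply, Pi.smul_apply, h2, h1]
    simp only [smul_eq_mul]
    field_simp [hne ξ]
  · rintro ⟨hu, rfl⟩
    apply Lp.ext
    filter_upwards [hm, mulPMap_coeFn symbol ⟨u, hu⟩,
      Lp.coeFn_add ((c : ℂ) • mulPMap symbol ⟨u, hu⟩) ((κ : ℂ) • u),
      Lp.coeFn_smul (c : ℂ) (mulPMap symbol ⟨u, hu⟩), Lp.coeFn_smul (κ : ℂ) u]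
      with ξ h1 h2 h3 h4 h5
    rw [h1, h3, Pi.add_apply, h4, h5, Pi.smul_apply, Pi.smul_apply, h2]
    simp only [smul_eq_mul]
    field_simp [hne ξ]

/-- `resolvent` is the two-sided inverse of the unbounded operator `c(-Δ)^{1/2} + κ`. -/
theorem resolvent_eq_iff (d : ℕ) {c κ : ℝ} (hc : 0 < c) (hκ : 0 < κ) (f u : L2 d) :
    resolvent d hc hκ f = u ↔ ∃ hu : u ∈ (sqrtLaplacian d).domain,
      (c : ℂ) • sqrtLaplacian d ⟨u, hu⟩ + (κ : ℂ) • u = f := by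
  rw [resolvent_apply, LinearIsometryEquiv.symm_apply_eq, mulOp_resolventSymbol_eq_iff d hc hκ]
  refine exists_congr fun hu ↦ ?_
  rw [← (fourierL2 d).injective.eq_iff (b := f), map_add, map_smul, map_smul]
  change _ ↔ (c : ℂ) • fourierL2 d ((fourierL2 d).symm (mulPMap symbol ⟨fourierL2 d u, hu⟩)) +
    (κ : ℂ) • fourierL2 d u = _
  rw [LinearIsometryEquiv.apply_symm_apply]

/-- The Hilbert space `L²(ℝᵈ) × L²(ℝᵈ)` with the norm `(‖ψ‖² + ‖φ‖²)^{1/2}`. -/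
abbrev State (d : ℕ) : Type := WithLp 2 (L2 d × L2 d)

/-- The Hamiltonian `H (ψ, φ) = (c(-Δ)^{1/2} ψ + g√ρ φ, g√ρ ψ + Ω φ)` with domain
`H¹(ℝᵈ) × L²(ℝᵈ)`. -/
def hamiltonian {d : ℕ} (c g Ω : ℝ) {ρ : EuclideanSpace ℝ (Fin d) → ℝ} (hρ : IsDensity ρ) :
    State d →ₗ.[ℂ] State d where
  domain := ((sqrtLaplacian d).domain.prod ⊤).comap
    (WithLp.linearEquiv 2 ℂ (L2 d × L2 d)).toLinearMap
  toFun :=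
    { toFun := fun u ↦ WithLp.toLp 2
        ((c : ℂ) • sqrtLaplacian d ⟨u.1.fst, u.2.1⟩ + (g : ℂ) • mulSqrt hρ u.1.snd,
          (g : ℂ) • mulSqrt hρ u.1.fst + (Ω : ℂ) • u.1.snd)
      map_add' := fun u v ↦ by
        have h : sqrtLaplacian d ⟨(u + v).1.fst, (u + v).2.1⟩ =
            sqrtLaplacian d ⟨u.1.fst, u.2.1⟩ + sqrtLaplacian d ⟨v.1.fst, v.2.1⟩ :=
          (sqrtLaplacian d).map_add ⟨u.1.fst, u.2.1⟩ ⟨v.1.fst, v.2.1⟩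
        rw [h, ← WithLp.toLp_add, Prod.mk_add_mk]
        simp only [Submodule.coe_add, WithLp.add_fst, WithLp.add_snd, map_add, smul_add]
        congr 2 <;> abel
      map_smul' := fun a u ↦ by
        have h : sqrtLaplacian d ⟨(a • u).1.fst, (a • u).2.1⟩ =
            a • sqrtLaplacian d ⟨u.1.fst, u.2.1⟩ :=
          (sqrtLaplacian d).map_smul a ⟨u.1.fst, u.2.1⟩
        rw [h, RingHom.id_apply, ← WithLp.toLp_smul, Prod.smul_mk]
        simp only [Submodule.coe_smul, WithLp.smul_fst, WithLp.smul_snd, map_smul, smul_add,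
          smul_comm a] }

/-- The Birman-Schwinger operator
`K_ω[ρ] = g² √ρ (c(-Δ)^{1/2} + |ω|)⁻¹ √ρ / (Ω + |ω|)` on `L²(ℝᵈ)`, for `c > 0` and `ω < 0`. -/
def birmanSchwingerOp {d : ℕ} {c : ℝ} (hc : 0 < c) (g Ω : ℝ)
    {ρ : EuclideanSpace ℝ (Fin d) → ℝ} (hρ : IsDensity ρ) {ω : ℝ} (hω : ω < 0) :
    L2 d →L[ℂ] L2 d :=
  ((g ^ 2 / (Ω + |ω|) : ℝ) : ℂ) •
    (mulSqrt hρ ∘L resolvent d hc (abs_pos.2 hω.ne) ∘L mulSqrt hρ)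

/-- The space `{u ∈ dom T : T u = z u}` of a partially defined linear operator `T`. -/
def eigenspace {V : Type*} [AddCommGroup V] [Module ℂ V] (T : V →ₗ.[ℂ] V) (z : ℂ) :
    Submodule ℂ V where
  carrier := {u | ∃ hu : u ∈ T.domain, T ⟨u, hu⟩ = z • u}
  add_mem' := by
    rintro u v ⟨hu, hu'⟩ ⟨hv, hv'⟩
    refine ⟨T.domain.add_mem hu hv, ?_⟩
    rw [smul_add, ← hu', ← hv']
    exact T.map_add ⟨u, hu⟩ ⟨v, hv⟩
  zero_mem' := ⟨T.domain.zero_mem, by rw [smul_zero]; exact T.map_zero⟩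
  smul_mem' := by
    rintro a u ⟨hu, hu'⟩
    refine ⟨T.domain.smul_mem a hu, ?_⟩
    rw [smul_comm, ← hu']
    exact T.map_smul a ⟨u, hu⟩

/-- The number of eigenvalues of `T` in a set `I` of real numbers, each counted with its
multiplicity, the dimension of the eigenspace (which is `0` when the number is not an
eigenvalue). It is a cardinal number, so that it is meaningful when it is infinite. -/
def eigenvalueCount {V : Type*} [AddCommGroup V] [Module ℂ V] (T : V →ₗ.[ℂ] V) (I : Set ℝ) :
    Cardinal :=
  Cardinal.sum fun x : I ↦ Module.rank ℂ (eigenspace T ((x : ℝ) : ℂ))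

/-- A bounded operator as an operator with domain the whole space. -/
def everywhereDefined {V : Type*} [NormedAddCommGroup V] [NormedSpace ℂ V] (T : V →L[ℂ] V) :
    V →ₗ.[ℂ] V :=
  T.toLinearMap.toPMap ⊤

end BirmanSchwinger

end

/-! Write an eigenvalue of `H` as `-μ` with `μ > 0`. The first row of the eigenvalue equation gives
`ψ = -g (c(-Δ)^{1/2} + μ)⁻¹ √ρ φ`, and the second row then says `A μ φ = φ`, where `A μ` is the
Birman-Schwinger operator at `ω = -μ`. Hence the multiplicity of `-μ` for `H` is that of the
eigenvalue `1` of `A μ` (`rank_eigenspace_hamiltonian`), and it remains to count, over all `μ ≥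
|ω|`, how often an eigenvalue of `A μ` equals `1`.

The operators `A μ` are positive and compact, norm continuous in `μ`, strictly decreasing where
their quadratic form is positive, and of norm below `1` for large `μ`. Let `N μ` be the number of
eigenvalues of `A μ` in `[1, ∞)`. As `μ` grows the eigenvalues move down, and each of those counted
by `N |ω|` crosses `1` exactly once. To avoid following eigenvalue branches, this is proved with `N`
alone: by min-max comparison, `N` is nonincreasing and left-continuous, and its right limit at `μ`
is the number `N' μ` of eigenvalues in `(1, ∞)`. The jump `N μ - N' μ` is thus the multiplicity of
`1`, and the jumps add up to `N |ω|` (`sum_jumps_eq`, `sum_rank_eigenspace_one`).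

Compactness holds because `√ρ` localizes in space and the resolvent symbol decays in frequency
(`isCompactOperator_mulSqrt_resolvent`). -/

noncomputable section

namespace BirmanSchwinger

open Module End
open scoped InnerProductSpace Topology

/-! ### Jumps of an integer-valued step function -/

section Counting

/-- A nonincreasing integer-valued function on `[κ, ∞)` which is left-continuous and vanishes
eventually has its value at `κ` equal to the sum of its jumps `N μ - N' μ`, where `N' μ` is the
right limit at `μ`. -/
theorem sum_jumps_eq {κ : ℝ} {N N' : ℝ → ℕ} (hN : AntitoneOn N (Set.Ici κ))
    (hright : ∀ μ, κ ≤ μ → ∀ k, k + 1 ≤ N' μ ↔ ∃ ν, μ < ν ∧ k + 1 ≤ N ν)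
    (hleft : ∀ μ, κ < μ → ∃ ν, κ ≤ ν ∧ ν < μ ∧ N ν ≤ N μ)
    (htop : ∃ M, ∀ ν, M ≤ ν → N ν = 0) :
    Cardinal.sum (fun μ : Set.Ici κ ↦ ((N μ - N' μ : ℕ) : Cardinal.{0})) = (N κ : Cardinal.{0}) := by
  obtain ⟨M, hM⟩ := htop
  -- The supremum `x j` of `S j` is the point where `N` drops below `j + 1`, so a jump of height `k`
  -- is hit by `k` indices `j`.
  let S : ℕ → Set ℝ := fun j ↦ {μ | κ ≤ μ ∧ j + 1 ≤ N μ}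
  have hbdd : ∀ j, BddAbove (S j) := fun j ↦ ⟨M, fun μ hμ ↦ by
    by_contra! h
    have := hM μ h.le
    have := hμ.2
    omega⟩
  have hmem : ∀ j : Fin (N κ), κ ∈ S j := fun j ↦ ⟨le_rfl, j.2⟩
  let x : Fin (N κ) → ℝ := fun j ↦ sSup (S j)
  have hx : ∀ j, κ ≤ x j := fun j ↦ le_csSup (hbdd j) (hmem j)
  -- Left-continuity makes the supremum a maximum; at `x j = κ`, where nothing lies to the left, `j
  -- < N κ` suffices.
  have hxS : ∀ j : Fin (N κ), (j : ℕ) + 1 ≤ N (x j) := fun j ↦ by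
    by_contra! h
    have hlt : κ < x j := by
      refine lt_of_le_of_ne (hx j) fun e ↦ ?_
      rw [← e] at h
      have := j.2
      omega
    obtain ⟨ν, hν, hνx, hle⟩ := hleft _ hlt
    obtain ⟨μ, hμ, hνμ⟩ := exists_lt_of_lt_csSup ⟨κ, hmem j⟩ hνx
    have h1 := hN hν hμ.1 hνμ.le
    have h2 := hμ.2
    omega
  have key : ∀ (j : Fin (N κ)) μ, κ ≤ μ → ((j : ℕ) + 1 ≤ N μ ↔ μ ≤ x j) := fun j μ hμ ↦
    ⟨fun h ↦ le_csSup (hbdd j) ⟨hμ, h⟩, fun h ↦ (hxS j).trans (hN hμ (hx j) h)⟩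
  have key' : ∀ (j : Fin (N κ)) μ, κ ≤ μ → ((j : ℕ) + 1 ≤ N' μ ↔ μ < x j) := fun j μ hμ ↦ by
    rw [hright μ hμ]
    exact ⟨fun ⟨ν, h1, h2⟩ ↦ h1.trans_le ((key j ν (hμ.trans h1.le)).1 h2),
      fun h ↦ ⟨x j, h, hxS j⟩⟩
  let y : Fin (N κ) → Set.Ici κ := fun j ↦ ⟨x j, hx j⟩
  -- The fibre of `x` over `μ` consists of the `j` with `N' μ ≤ j < N μ`.
  have hfib : ∀ μ : Set.Ici κ,
      ((N μ - N' μ : ℕ) : Cardinal.{0}) = Cardinal.mk {j // y j = μ} := fun μ ↦ by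
    have hle : N μ ≤ N κ := hN (Set.self_mem_Ici) μ.2 μ.2
    have hiff : ∀ j : Fin (N κ), y j = μ ↔ (j : ℕ) ∈ Finset.Ico (N' μ) (N μ) := fun j ↦ by
      have h1 := key j μ μ.2
      have h2 := key' j μ μ.2
      rw [Finset.mem_Ico, Subtype.ext_iff]
      change x j = μ ↔ _
      constructor
      · intro h
        have a := h1.2 h.ge
        have b : ¬ (j : ℕ) + 1 ≤ N' μ := fun hh ↦ (h2.1 hh).ne' h
        omega
      · rintro ⟨ha, hb⟩
        refine le_antisymm (not_lt.1 fun hh ↦ ?_) (h1.1 hb)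
        have := h2.2 hh
        omega
    have e : {j // y j = μ} ≃ Finset.Ico (N' μ) (N μ) :=
      { toFun := fun j ↦ ⟨j.1, (hiff j.1).1 j.2⟩
        invFun := fun i ↦ ⟨⟨i.1, (Finset.mem_Ico.1 i.2).2.trans_le hle⟩, (hiff _).2 i.2⟩
        left_inv := fun _ ↦ rfl
        right_inv := fun _ ↦ rfl }
    rw [Cardinal.mk_congr e, Cardinal.mk_coe_finset, Nat.card_Ico]
  simp_rw [hfib]
  rw [← Cardinal.mk_sigma, Cardinal.mk_congr (Equiv.sigmaFiberEquiv y), Cardinal.mk_fin]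

end Counting

/-! ### Spectral subspaces of symmetric and of compact positive operators -/

section Spectral

variable {E : Type*} [NormedAddCommGroup E] [InnerProductSpace ℂ E]

/-- The span of the eigenspaces of `T` to eigenvalues in a set `I` of real numbers. -/
def spectralSubspace (T : E →L[ℂ] E) (I : Set ℝ) : Submodule ℂ E :=
  ⨆ s : I, Module.End.eigenspace (T : E →ₗ[ℂ] E) ((s : ℝ) : ℂ)

theorem eigenspace_le_spectralSubspace (T : E →L[ℂ] E) {I : Set ℝ} {s : ℝ} (hs : s ∈ I) :
    Module.End.eigenspace (T : E →ₗ[ℂ] E) (s : ℂ) ≤ spectralSubspace T I :=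
  le_iSup (fun s : I ↦ Module.End.eigenspace (T : E →ₗ[ℂ] E) ((s : ℝ) : ℂ)) ⟨s, hs⟩

theorem orthogonalFamily_real_eigenspaces {T : E →L[ℂ] E} (hT : T.IsSymmetric) (I : Set ℝ) :
    OrthogonalFamily ℂ (fun s : I ↦ Module.End.eigenspace (T : E →ₗ[ℂ] E) ((s : ℝ) : ℂ))
      fun s ↦ (Module.End.eigenspace (T : E →ₗ[ℂ] E) ((s : ℝ) : ℂ)).subtypeₗᵢ :=
  hT.orthogonalFamily_eigenspaces.comp (γ := I) (f := fun s ↦ ((s : ℝ) : ℂ))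
    (Complex.ofReal_injective.comp Subtype.coe_injective)

/-- Vectors in a spectral subspace, as orthogonal sums of eigenvectors. -/
theorem exists_sum_of_mem_spectralSubspace {T : E →L[ℂ] E} (hT : T.IsSymmetric) {I : Set ℝ}
    {f : E} (hf : f ∈ spectralSubspace T I) :
    ∃ v : I →₀ E, ‖f‖ ^ 2 = v.sum (fun _ w ↦ ‖w‖ ^ 2) ∧
      (⟪T f, f⟫_ℂ).re = v.sum fun s w ↦ (s : ℝ) * ‖w‖ ^ 2 := by
  obtain ⟨v, hv, rfl⟩ := (Submodule.mem_iSup_iff_exists_finsupp _ _).1 hf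
  have hort : ∀ i j : I, i ≠ j → ⟪v i, v j⟫_ℂ = 0 := fun i j hij ↦
    orthogonalFamily_real_eigenspaces hT I hij ⟨v i, hv i⟩ ⟨v j, hv j⟩
  have hTv : ∀ i, T (v i) = ((i : ℝ) : ℂ) • v i := fun i ↦ Module.End.mem_eigenspace_iff.1 (hv i)
  refine ⟨v, ?_, ?_⟩
  · have : (⟪v.sum fun _ x ↦ x, v.sum fun _ x ↦ x⟫_ℂ) = ((v.sum fun _ w ↦ ‖w‖ ^ 2 : ℝ) : ℂ) := by
      rw [Finsupp.sum, Finsupp.sum, sum_inner]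
      push_cast
      refine Finset.sum_congr rfl fun i hi ↦ ?_
      rw [inner_sum, Finset.sum_eq_single i (fun j _ hj ↦ hort i j hj.symm)
        (fun h ↦ (h hi).elim), inner_self_eq_norm_sq_to_K]
      rfl
    rw [← inner_self_eq_norm_sq (𝕜 := ℂ), this]
    exact Complex.ofReal_re _
  · have : (⟪T (v.sum fun _ x ↦ x), v.sum fun _ x ↦ x⟫_ℂ) =
        ((v.sum fun s w ↦ (s : ℝ) * ‖w‖ ^ 2 : ℝ) : ℂ) := by
      rw [Finsupp.sum, Finsupp.sum, map_sum, sum_inner]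
      push_cast
      refine Finset.sum_congr rfl fun i hi ↦ ?_
      rw [inner_sum, Finset.sum_eq_single i (fun j _ hj ↦ ?_) (fun h ↦ (h hi).elim), hTv,
        inner_smul_left, inner_self_eq_norm_sq_to_K, Complex.conj_ofReal]
      · rfl
      · rw [hTv, inner_smul_left, hort i j hj.symm, mul_zero]
    rw [this]
    exact Complex.ofReal_re _

theorem le_inner_of_mem_spectralSubspace {T : E →L[ℂ] E} (hT : T.IsSymmetric) {I : Set ℝ} {a : ℝ}
    (hI : I ⊆ Set.Ici a) {f : E} (hf : f ∈ spectralSubspace T I) :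
    a * ‖f‖ ^ 2 ≤ (⟪T f, f⟫_ℂ).re := by
  obtain ⟨v, h1, h2⟩ := exists_sum_of_mem_spectralSubspace hT hf
  rw [h1, h2, Finsupp.sum, Finsupp.sum, Finset.mul_sum]
  exact Finset.sum_le_sum fun s _ ↦ mul_le_mul_of_nonneg_right (hI s.2) (by positivity)

theorem lt_inner_of_mem_spectralSubspace {T : E →L[ℂ] E} (hT : T.IsSymmetric) {I : Set ℝ} {a : ℝ}
    (hI : I ⊆ Set.Ioi a) {f : E} (hf : f ∈ spectralSubspace T I) (h0 : f ≠ 0) :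
    a * ‖f‖ ^ 2 < (⟪T f, f⟫_ℂ).re := by
  obtain ⟨v, h1, h2⟩ := exists_sum_of_mem_spectralSubspace hT hf
  have hv : v.support.Nonempty := by
    rw [Finset.nonempty_iff_ne_empty]
    intro h
    rw [Finsupp.sum, h, Finset.sum_empty] at h1
    exact h0 (by simpa using h1)
  rw [h1, h2, Finsupp.sum, Finsupp.sum, Finset.mul_sum]
  refine Finset.sum_lt_sum_of_nonempty hv fun s hs ↦ ?_
  have : 0 < ‖v s‖ := norm_pos_iff.2 (Finsupp.mem_support_iff.1 hs)
  exact mul_lt_mul_of_pos_right (hI s.2) (by positivity)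

theorem map_mem_spectralSubspace (T : E →L[ℂ] E) (I : Set ℝ) {f : E}
    (hf : f ∈ spectralSubspace T I) : T f ∈ spectralSubspace T I := by
  refine Submodule.iSup_induction _ (motive := fun f ↦ T f ∈ spectralSubspace T I) hf
    (fun s x hx ↦ ?_) (by simp) fun x y hx hy ↦ by
      rw [map_add]; exact add_mem hx hy
  have : T x = ((s : ℝ) : ℂ) • x := Module.End.mem_eigenspace_iff.1 hx
  rw [this]
  exact Submodule.smul_mem _ _ (eigenspace_le_spectralSubspace T s.2 hx)

theorem map_mem_spectralSubspace_orthogonal {T : E →L[ℂ] E} (hT : T.IsSymmetric) (I : Set ℝ) {f : E}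
    (hf : f ∈ (spectralSubspace T I)ᗮ) : T f ∈ (spectralSubspace T I)ᗮ := fun w hw ↦ by
  have := hT w f
  rw [ContinuousLinearMap.coe_coe] at this
  rw [← this]
  exact hf _ (map_mem_spectralSubspace T I hw)

/-- Eigenspaces to distinct eigenvalues are orthogonal, so their span is their direct sum. -/
theorem cardinal_sum_rank_eigenspace {T : E →L[ℂ] E} (hT : T.IsSymmetric) (I : Set ℝ) :
    Cardinal.sum (fun s : I ↦
      Module.rank ℂ (Module.End.eigenspace (T : E →ₗ[ℂ] E) ((s : ℝ) : ℂ))) =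
      Cardinal.lift.{0} (Module.rank ℂ (spectralSubspace T I)) := by
  classical
  have hind := (orthogonalFamily_real_eigenspaces hT I).independent
  rw [← rank_directSum, Cardinal.lift_uzero, spectralSubspace, ← DirectSum.range_coeLinearMap]
  exact (LinearEquiv.ofInjective (DirectSum.coeLinearMap _) hind.dfinsupp_lsum_injective).rank_eq

variable [CompleteSpace E]

/-- On the closure of the spectral subspace the form of `T` is at least `a > 0` times the squared
norm, so the restriction of `T` is invertible as well as compact. The identity is then compact.
Passing to the closure provides the completeness that invertibility needs. -/
theorem finiteDimensional_spectralSubspace {T : E →L[ℂ] E} (hT : T.IsSymmetric)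
    (hc : IsCompactOperator T) {I : Set ℝ} {a : ℝ} (ha : 0 < a) (hI : I ⊆ Set.Ici a) :
    FiniteDimensional ℂ (spectralSubspace T I) := by
  set W := (spectralSubspace T I).topologicalClosure
  have hW : ∀ f ∈ W, a * ‖f‖ ^ 2 ≤ (⟪T f, f⟫_ℂ).re := fun f hf ↦ by
    refine closure_minimal (s := (spectralSubspace T I : Set E))
      (t := {f | a * ‖f‖ ^ 2 ≤ (⟪T f, f⟫_ℂ).re})
      (fun f hf ↦ le_inner_of_mem_spectralSubspace hT hI hf) ?_ hf
    exact isClosed_le (by fun_prop) (by fun_prop)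
  have hinv : ∀ f ∈ W, T f ∈ W := fun f hf ↦
    map_mem_closure T.continuous hf fun g hg ↦ map_mem_spectralSubspace T I hg
  have : CompleteSpace W := (Submodule.isClosed_topologicalClosure _).completeSpace_coe
  have hS := hc.restrict' (f := (T : E →ₗ[ℂ] E)) (V := W) hinv
  let S : W →L[ℂ] W := T.restrict hinv
  have hu : IsUnit S := by
    refine ContinuousLinearMap.isUnit_of_forall_le_norm_inner_map S (c := ⟨a, ha.le⟩) ha fun f ↦ ?_
    calc ‖f‖ ^ 2 * a = a * ‖(f : E)‖ ^ 2 := mul_comm _ _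
      _ ≤ (⟪T f, (f : E)⟫_ℂ).re := hW f f.2
      _ ≤ ‖⟪T f, (f : E)⟫_ℂ‖ := Complex.re_le_norm _
  obtain ⟨R', hR'⟩ := hu.exists_left_inv
  have hid := IsCompactOperator.clm_comp (f := S) hS R'
  have e : ⇑R' ∘ ⇑S = id := funext fun f ↦ congrArg (fun B : W →L[ℂ] W ↦ B f) hR'
  rw [e] at hid
  have : FiniteDimensional ℂ W := FiniteDimensional.of_isCompactOperator_id hid
  exact Submodule.finiteDimensional_of_le (Submodule.le_topologicalClosure _)

/-- The spectral radius of a self-adjoint operator is its norm and is attained in the spectrum. A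
nonzero spectral value of a compact operator is an eigenvalue, and positivity excludes the value
`-‖T‖`. -/
theorem hasEigenvalue_norm {F : Type*} [NormedAddCommGroup F] [InnerProductSpace ℂ F]
    [CompleteSpace F] {T : F →L[ℂ] F} (hT : T.IsPositive) (hc : IsCompactOperator T) (h0 : ‖T‖ ≠ 0) :
    HasEigenvalue (T : Module.End ℂ F) ((‖T‖ : ℝ) : ℂ) := by
  have : Nontrivial F := by
    by_contra h
    rw [not_nontrivial_iff_subsingleton] at h
    exact h0 (by rw [Subsingleton.elim T 0, norm_zero])
  obtain ⟨z, hz, hzn⟩ := spectrum.exists_nnnorm_eq_spectralRadius T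
  rw [T.spectralRadius_eq_nnnorm hT.isSelfAdjoint, ENNReal.coe_inj] at hzn
  have hzn' : ‖z‖ = ‖T‖ := congrArg NNReal.toReal hzn
  have hz0 : z ≠ 0 := by
    rwa [← norm_ne_zero_iff, hzn']
  have he := (hc.hasEigenvalue_iff_mem_spectrum hz0).2 hz
  have hreal := Complex.conj_eq_iff_re.1 (hT.isSymmetric.conj_eigenvalue_eq_self he)
  have hnn : 0 ≤ z.re := by
    rw [← hreal] at he
    exact eigenvalue_nonneg_of_nonneg he fun x ↦ hT.re_inner_nonneg_right x
  have : ‖z‖ = z.re := by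
    rw [← hreal, Complex.norm_real, Real.norm_of_nonneg hnn]; simp
  rw [← hzn', this, hreal]
  exact he

/-- On the orthogonal complement of a spectral subspace, a compact positive operator is bounded by
a number `r` which is zero or not in the set. -/
theorem exists_inner_le_of_mem_orthogonal {T : E →L[ℂ] E} (hT : T.IsPositive)
    (hc : IsCompactOperator T) (I : Set ℝ) :
    ∃ r : ℝ, (r = 0 ∨ r ∉ I) ∧ ∀ f ∈ (spectralSubspace T I)ᗮ, (⟪T f, f⟫_ℂ).re ≤ r * ‖f‖ ^ 2 := by
  have hinv : ∀ f ∈ (spectralSubspace T I)ᗮ, T f ∈ (spectralSubspace T I)ᗮ := fun f hf ↦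
    map_mem_spectralSubspace_orthogonal hT.isSymmetric I hf
  have hcS := hc.restrict' (f := (T : E →ₗ[ℂ] E)) hinv
  let S : (spectralSubspace T I)ᗮ →L[ℂ] (spectralSubspace T I)ᗮ := T.restrict hinv
  have hS : S.IsPositive := by
    refine S.isPositive_def.2 ⟨hT.isSymmetric.restrict_invariant hinv, fun x ↦ ?_⟩
    exact hT.re_inner_nonneg_left (x : E)
  -- If `‖S‖` were nonzero and in `I`, an eigenvector of `S` to it would lie both in the spectral
  -- subspace and in its orthogonal complement.
  refine ⟨‖S‖, ?_, fun f hf ↦ ?_⟩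
  · by_cases h0 : ‖S‖ = 0
    · exact Or.inl h0
    right
    intro hmem
    obtain ⟨v, hv, hv0⟩ := (hasEigenvalue_norm hS hcS h0).exists_hasEigenvector
    have hv' : (v : E) ∈ Module.End.eigenspace (T : E →ₗ[ℂ] E) ((‖S‖ : ℝ) : ℂ) :=
      Module.End.mem_eigenspace_iff.2 (congrArg Subtype.val (Module.End.mem_eigenspace_iff.1 hv))
    have := v.2 _ (eigenspace_le_spectralSubspace T hmem hv')
    exact hv0 (Subtype.ext (inner_self_eq_zero.1 this))
  · calc (⟪T f, f⟫_ℂ).re ≤ ‖⟪T f, f⟫_ℂ‖ := Complex.re_le_norm _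
      _ ≤ ‖S ⟨f, hf⟩‖ * ‖f‖ := norm_inner_le_norm (T f) f
      _ ≤ ‖S‖ * ‖f‖ * ‖f‖ := by gcongr; exact S.le_opNorm ⟨f, hf⟩
      _ = _ := by ring

end Spectral

/-! ### Min-max comparison and crossings of the value `1` -/

section Family

variable {E : Type*} [NormedAddCommGroup E] [InnerProductSpace ℂ E]

/-- The orthogonal projection onto `W` has kernel `Wᗮ`, hence is injective on `V`. -/
theorem finrank_le_of_forall_mem_orthogonal {V W : Submodule ℂ E} [FiniteDimensional ℂ W]
    (h : ∀ f ∈ V, f ∈ Wᗮ → f = 0) : finrank ℂ V ≤ finrank ℂ W := by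
  refine LinearMap.finrank_le_finrank_of_injective
    (f := (W.orthogonalProjectionOnto : E →ₗ[ℂ] W) ∘ₗ V.subtype) ?_
  rw [← LinearMap.ker_eq_bot, LinearMap.ker_eq_bot']
  intro f hf
  exact Subtype.ext (h f f.2 (Submodule.orthogonalProjectionOnto_eq_zero_iff.1 hf))

theorem abs_re_inner_sub_le (S T : E →L[ℂ] E) (f : E) :
    |(⟪S f, f⟫_ℂ).re - (⟪T f, f⟫_ℂ).re| ≤ ‖S - T‖ * ‖f‖ ^ 2 := by
  rw [← Complex.sub_re, ← inner_sub_left, ← sub_apply]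
  calc _ ≤ ‖⟪(S - T) f, f⟫_ℂ‖ := Complex.abs_re_le_norm _
    _ ≤ ‖(S - T) f‖ * ‖f‖ := norm_inner_le_norm _ _
    _ ≤ ‖S - T‖ * ‖f‖ * ‖f‖ := by gcongr; exact (S - T).le_opNorm f
    _ = _ := by ring

/-- A quadratic form that exceeds the square of the norm on a finite-dimensional subspace does so
uniformly. -/
theorem exists_uniform_lt_inner (T : E →L[ℂ] E) (V : Submodule ℂ E) [FiniteDimensional ℂ V]
    (h : ∀ f ∈ V, f ≠ 0 → ‖f‖ ^ 2 < (⟪T f, f⟫_ℂ).re) :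
    ∃ δ > 0, ∀ f ∈ V, (1 + δ) * ‖f‖ ^ 2 ≤ (⟪T f, f⟫_ℂ).re := by
  rcases subsingleton_or_nontrivial V with hV | hV
  · refine ⟨1, one_pos, fun f hf ↦ ?_⟩
    have : f = 0 := congrArg Subtype.val (Subsingleton.elim (⟨f, hf⟩ : V) 0)
    simp [this]
  have : ProperSpace V := FiniteDimensional.proper ℂ V
  have hne : (Metric.sphere (0 : V) 1).Nonempty := by
    obtain ⟨v, hv⟩ := exists_ne (0 : V)
    exact ⟨((‖v‖⁻¹ : ℝ) : ℂ) • v, by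
      simp only [mem_sphere_zero_iff_norm, norm_smul, Complex.norm_real, norm_inv, norm_norm]
      exact inv_mul_cancel₀ (norm_ne_zero_iff.2 hv)⟩
  obtain ⟨v, hv, hmin⟩ := (isCompact_sphere (0 : V) 1).exists_isMinOn hne
    (f := fun v : V ↦ (⟪T v, (v : E)⟫_ℂ).re) (by fun_prop)
  have hv1 : ‖(v : E)‖ = 1 := by simpa using hv
  -- By compactness of the unit sphere of `V` the form attains its minimum there, which exceeds `1`;
  -- `δ` is the excess.
  refine ⟨(⟪T v, (v : E)⟫_ℂ).re - 1, ?_, fun f hf ↦ ?_⟩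
  · have := h v v.2 (by rw [← norm_ne_zero_iff, hv1]; exact one_ne_zero)
    rw [hv1] at this
    linarith
  · by_cases h0 : f = 0
    · simp [h0]
    have hn : ‖f‖ ≠ 0 := norm_ne_zero_iff.2 h0
    let w : V := ((‖f‖⁻¹ : ℝ) : ℂ) • ⟨f, hf⟩
    have hw : w ∈ Metric.sphere (0 : V) 1 := by simp [w, norm_smul, hn]
    have h1 := hmin hw
    have h2 : (⟪T w, (w : E)⟫_ℂ).re = ‖f‖⁻¹ * (‖f‖⁻¹ * (⟪T f, f⟫_ℂ).re) := by
      simp only [w, Submodule.coe_smul, map_smul, inner_smul_left, inner_smul_right,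
        Complex.conj_ofReal, Complex.re_ofReal_mul]
    simp only [Set.mem_ofPred_eq, h2] at h1
    have hp : 0 < ‖f‖ := lt_of_le_of_ne (norm_nonneg _) hn.symm
    calc _ = (⟪T v, (v : E)⟫_ℂ).re * ‖f‖ ^ 2 := by ring
      _ ≤ (‖f‖⁻¹ * (‖f‖⁻¹ * (⟪T f, f⟫_ℂ).re)) * ‖f‖ ^ 2 := by gcongr
      _ = _ := by field_simp

variable [CompleteSpace E]

/-- Identifies the jump of the counting function with the multiplicity of the eigenvalue `1`: the
form exceeds `‖f‖ ^ 2` on nonzero vectors of one summand and equals it on the other, so they meet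
only in zero. -/
theorem finrank_spectralSubspace_Ici {T : E →L[ℂ] E} (hT : T.IsPositive)
    (hc : IsCompactOperator T) :
    finrank ℂ (spectralSubspace T (Set.Ici 1)) = finrank ℂ (spectralSubspace T (Set.Ioi 1)) +
      finrank ℂ (Module.End.eigenspace (T : E →ₗ[ℂ] E) 1) := by
  have hfin := finiteDimensional_spectralSubspace hT.isSymmetric hc one_pos
    (Set.Ioi_subset_Ici_self (a := (1 : ℝ)))
  have hfin1 : FiniteDimensional ℂ (Module.End.eigenspace (T : E →ₗ[ℂ] E) 1) :=
    ContinuousLinearMap.finite_dimensional_eigenspace hc 1 one_ne_zero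
  have hsup : spectralSubspace T (Set.Ici 1) =
      spectralSubspace T (Set.Ioi 1) ⊔ Module.End.eigenspace (T : E →ₗ[ℂ] E) 1 := by
    refine le_antisymm (iSup_le fun s ↦ ?_) (sup_le (iSup_le fun s ↦ ?_) ?_)
    · rcases eq_or_lt_of_le (Set.mem_Ici.1 s.2) with h | h
      · rw [← h, Complex.ofReal_one]
        exact le_sup_right
      · exact (eigenspace_le_spectralSubspace T (Set.mem_Ioi.2 h)).trans le_sup_left
    · exact eigenspace_le_spectralSubspace T (Set.Ioi_subset_Ici_self s.2)
    · have := eigenspace_le_spectralSubspace T (Set.self_mem_Ici (a := (1 : ℝ)))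
      rwa [Complex.ofReal_one] at this
  have hinf : spectralSubspace T (Set.Ioi 1) ⊓ Module.End.eigenspace (T : E →ₗ[ℂ] E) 1 = ⊥ := by
    rw [Submodule.eq_bot_iff]
    rintro f ⟨h1, h2⟩
    by_contra h0
    have h3 := lt_inner_of_mem_spectralSubspace hT.isSymmetric subset_rfl h1 h0
    have h4 : T f = (1 : ℂ) • f := Module.End.mem_eigenspace_iff.1 h2
    have h5 : (⟪f, f⟫_ℂ).re = ‖f‖ ^ 2 := inner_self_eq_norm_sq (𝕜 := ℂ) f
    rw [h4, one_smul, h5, one_mul] at h3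
    exact lt_irrefl _ h3
  have := Submodule.finrank_sup_add_finrank_inf_eq (spectralSubspace T (Set.Ioi 1))
    (Module.End.eigenspace (T : E →ₗ[ℂ] E) 1)
  rw [hinf, finrank_bot, add_zero] at this
  rw [hsup, this]

/-- The upper bound of the min-max principle, stable under small perturbations. -/
theorem exists_finrank_le_spectralSubspace_Ici {T : E →L[ℂ] E} (hT : T.IsPositive)
    (hc : IsCompactOperator T) :
    ∃ ε > 0, ∀ S : E →L[ℂ] E, ‖S - T‖ < ε → ∀ V : Submodule ℂ E,
      (∀ f ∈ V, ‖f‖ ^ 2 ≤ (⟪S f, f⟫_ℂ).re) →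
        finrank ℂ V ≤ finrank ℂ (spectralSubspace T (Set.Ici 1)) := by
  obtain ⟨r, hr, hle⟩ := exists_inner_le_of_mem_orthogonal hT hc (Set.Ici 1)
  have hr1 : r < 1 := by
    rcases hr with h | h
    · rw [h]; exact one_pos
    · simpa using h
  have := finiteDimensional_spectralSubspace hT.isSymmetric hc one_pos
    (subset_refl (Set.Ici (1 : ℝ)))
  -- On the orthogonal complement the form of `T` is at most `r ‖f‖ ^ 2` with `r < 1`, so a
  -- perturbation smaller than `1 - r` keeps it below `‖f‖ ^ 2` for `f ≠ 0`.
  refine ⟨1 - r, by linarith, fun S hS V hV ↦ finrank_le_of_forall_mem_orthogonal fun f hf hf' ↦ ?_⟩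
  by_contra h0
  have hp : 0 < ‖f‖ ^ 2 := by positivity
  have h1 := hV f hf
  have h2 := hle f hf'
  have h3 := (abs_le.1 (abs_re_inner_sub_le S T f)).2
  nlinarith

/-- Here the bound on the complement can be `r = 1`: the form on `V` has to be strictly larger, and
there is no room for a perturbation. -/
theorem finrank_le_spectralSubspace_Ioi {T : E →L[ℂ] E} (hT : T.IsPositive)
    (hc : IsCompactOperator T) (V : Submodule ℂ E)
    (hV : ∀ f ∈ V, f ≠ 0 → ‖f‖ ^ 2 < (⟪T f, f⟫_ℂ).re) :
    finrank ℂ V ≤ finrank ℂ (spectralSubspace T (Set.Ioi 1)) := by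
  obtain ⟨r, hr, hle⟩ := exists_inner_le_of_mem_orthogonal hT hc (Set.Ioi 1)
  have hr1 : r ≤ 1 := by
    rcases hr with h | h
    · rw [h]; exact zero_le_one
    · simpa using h
  have := finiteDimensional_spectralSubspace hT.isSymmetric hc one_pos
    (Set.Ioi_subset_Ici_self (a := (1 : ℝ)))
  refine finrank_le_of_forall_mem_orthogonal fun f hf hf' ↦ ?_
  by_contra h0
  have hp : 0 < ‖f‖ ^ 2 := by positivity
  have h1 := hV f hf h0
  have h2 := hle f hf'
  nlinarith

/-- The subspace is finite-dimensional, so the strict inequality holds with a margin `δ` that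
absorbs small perturbations. -/
theorem exists_le_inner_of_mem_spectralSubspace_Ioi {T : E →L[ℂ] E} (hT : T.IsPositive)
    (hc : IsCompactOperator T) :
    ∃ ε > 0, ∀ S : E →L[ℂ] E, ‖S - T‖ < ε → ∀ f ∈ spectralSubspace T (Set.Ioi 1),
      ‖f‖ ^ 2 ≤ (⟪S f, f⟫_ℂ).re := by
  have := finiteDimensional_spectralSubspace hT.isSymmetric hc one_pos
    (Set.Ioi_subset_Ici_self (a := (1 : ℝ)))
  obtain ⟨δ, hδ, h⟩ := exists_uniform_lt_inner T (spectralSubspace T (Set.Ioi 1)) fun f hf h0 ↦ by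
    simpa using lt_inner_of_mem_spectralSubspace hT.isSymmetric subset_rfl hf h0
  refine ⟨δ, hδ, fun S hS f hf ↦ ?_⟩
  have h1 := h f hf
  have h3 := (abs_le.1 (abs_re_inner_sub_le S T f)).1
  nlinarith [sq_nonneg ‖f‖]

end Family

/-- For a continuous and strictly decreasing family of compact positive operators which tends to
become small, the number of eigenvalues in `[1, ∞)` at `κ` is the number of crossings of the
value `1`. -/
theorem sum_rank_eigenspace_one {E : Type} [NormedAddCommGroup E] [InnerProductSpace ℂ E]
    [CompleteSpace E] {A : ℝ → E →L[ℂ] E} {κ : ℝ}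
    (hpos : ∀ μ, κ ≤ μ → (A μ).IsPositive) (hc : ∀ μ, κ ≤ μ → IsCompactOperator (A μ))
    (hcont : ContinuousOn A (Set.Ici κ))
    (hanti : ∀ μ ν, κ ≤ μ → μ < ν → ∀ f, 0 < (⟪A ν f, f⟫_ℂ).re →
      (⟪A ν f, f⟫_ℂ).re < (⟪A μ f, f⟫_ℂ).re)
    (htop : ∃ M, ∀ ν, M ≤ ν → ‖A ν‖ < 1) :
    Cardinal.sum (fun μ : Set.Ici κ ↦
      Module.rank ℂ (Module.End.eigenspace (A μ : E →ₗ[ℂ] E) 1)) =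
      Module.rank ℂ (spectralSubspace (A κ) (Set.Ici 1)) := by
  let N : ℝ → ℕ := fun μ ↦ finrank ℂ (spectralSubspace (A μ) (Set.Ici 1))
  let N' : ℝ → ℕ := fun μ ↦ finrank ℂ (spectralSubspace (A μ) (Set.Ioi 1))
  have hle1 : ∀ μ, κ ≤ μ → ∀ f ∈ spectralSubspace (A μ) (Set.Ici 1),
      ‖f‖ ^ 2 ≤ (⟪A μ f, f⟫_ℂ).re := fun μ hμ f hf ↦ by
    simpa using le_inner_of_mem_spectralSubspace (hpos μ hμ).isSymmetric subset_rfl hf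
  have hlt1 : ∀ μ ν, κ ≤ μ → μ < ν → ∀ f ∈ spectralSubspace (A ν) (Set.Ici 1), f ≠ 0 →
      ‖f‖ ^ 2 < (⟪A μ f, f⟫_ℂ).re := fun μ ν hμ hν f hf h0 ↦ by
    have h1 := hle1 ν (hμ.trans hν.le) f hf
    have hp : 0 < ‖f‖ ^ 2 := by positivity
    exact h1.trans_lt (hanti μ ν hμ hν f (hp.trans_le h1))
  -- Strict decrease turns "at least `1`" at `ν` into "greater than `1`" at any earlier `μ`.
  have hNle : ∀ μ ν, κ ≤ μ → μ < ν → N ν ≤ N' μ := fun μ ν hμ hν ↦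
    finrank_le_spectralSubspace_Ioi (hpos μ hμ) (hc μ hμ) _ (hlt1 μ ν hμ hν)
  have hN'N : ∀ μ, κ ≤ μ → N μ = N' μ + finrank ℂ (Module.End.eigenspace (A μ : E →ₗ[ℂ] E) 1) :=
    fun μ hμ ↦ finrank_spectralSubspace_Ici (hpos μ hμ) (hc μ hμ)
  have key := sum_jumps_eq (κ := κ) (N := N) (N' := N') ?_ ?_ ?_ ?_
  · have hfin := finiteDimensional_spectralSubspace (hpos κ le_rfl).isSymmetric (hc κ le_rfl)
      one_pos (subset_refl (Set.Ici (1 : ℝ)))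
    rw [← finrank_eq_rank, ← key]
    congr 1
    funext μ
    have hfin1 : FiniteDimensional ℂ (Module.End.eigenspace (A μ : E →ₗ[ℂ] E) 1) :=
      ContinuousLinearMap.finite_dimensional_eigenspace (hc μ μ.2) 1 one_ne_zero
    rw [← finrank_eq_rank, hN'N μ μ.2, Nat.add_sub_cancel_left]
  · intro μ hμ ν _ h
    rcases eq_or_lt_of_le h with rfl | h
    · exact le_rfl
    · exact (hNle μ ν hμ h).trans (by rw [hN'N μ hμ]; exact Nat.le_add_right _ _)
  -- The spectral subspace of `A μ` for `(1, ∞)` is still a test space for `A ν` when `ν > μ` is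
  -- close to `μ`, which gives `N' μ ≤ N ν`.
  · intro μ hμ k
    refine ⟨fun h ↦ ?_, fun ⟨ν, hν, h⟩ ↦ h.trans (hNle μ ν hμ hν)⟩
    obtain ⟨ε, hε, h1⟩ := exists_le_inner_of_mem_spectralSubspace_Ioi (hpos μ hμ) (hc μ hμ)
    have ht : Filter.Tendsto A (𝓝[>] μ) (𝓝 (A μ)) :=
      (hcont μ hμ).mono_left (nhdsWithin_mono _ fun ν hν ↦ hμ.trans (le_of_lt hν))
    obtain ⟨ν, hνε, hν⟩ := Filter.nonempty_of_mem
      (Filter.inter_mem (Filter.mem_map.1 (ht (Metric.ball_mem_nhds _ hε))) self_mem_nhdsWithin)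
    have hκν : κ ≤ ν := hμ.trans (le_of_lt hν)
    rw [Set.mem_preimage, mem_ball_iff_norm] at hνε
    refine ⟨ν, hν, h.trans ?_⟩
    obtain ⟨ε', hε', h2⟩ := exists_finrank_le_spectralSubspace_Ici (hpos ν hκν) (hc ν hκν)
    exact h2 (A ν) (by simpa using hε') _ (h1 _ hνε)
  -- Left-continuity: the perturbation-stable upper bound at `μ` is applied to the spectral subspace
  -- of a nearby `A ν` with `ν < μ`.
  · intro μ hμ
    obtain ⟨ε, hε, h1⟩ := exists_finrank_le_spectralSubspace_Ici (hpos μ hμ.le) (hc μ hμ.le)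
    have ht : Filter.Tendsto A (𝓝[Set.Ico κ μ] μ) (𝓝 (A μ)) :=
      (hcont μ hμ.le).mono_left (nhdsWithin_mono _ fun ν hν ↦ hν.1)
    have : (𝓝[Set.Ico κ μ] μ).NeBot := by
      rw [nhdsWithin_Ico_eq_nhdsLT hμ]; infer_instance
    obtain ⟨ν, hνε, hν⟩ := Filter.nonempty_of_mem
      (Filter.inter_mem (Filter.mem_map.1 (ht (Metric.ball_mem_nhds _ hε))) self_mem_nhdsWithin)
    rw [Set.mem_preimage, mem_ball_iff_norm] at hνε
    exact ⟨ν, hν.1, hν.2, h1 (A ν) hνε _ (hle1 ν hν.1)⟩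
  · obtain ⟨M, hM⟩ := htop
    refine ⟨max M κ, fun ν hν ↦ ?_⟩
    have hbot : spectralSubspace (A ν) (Set.Ici 1) = ⊥ := by
      rw [Submodule.eq_bot_iff]
      intro f hf
      by_contra h0
      have h1 := hle1 ν ((le_max_right _ _).trans hν) f hf
      have h2 := (abs_le.1 (abs_re_inner_sub_le (A ν) 0 f)).2
      have h3 := hM ν ((le_max_left _ _).trans hν)
      have hp : 0 < ‖f‖ ^ 2 := by positivity
      simp only [sub_zero, zero_apply, inner_zero_left, Complex.zero_re] at h2
      nlinarith
    change finrank ℂ (spectralSubspace (A ν) (Set.Ici 1)) = 0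
    rw [hbot, finrank_bot]

open scoped FourierTransform

/-! ### Multiplication operators -/

section Multiplication

variable {d : ℕ}

theorem norm_mulOp_le {m : EuclideanSpace ℝ (Fin d) → ℂ} (hm : MemLp m ∞ volume) {C : ℝ}
    (hC : 0 ≤ C) (h : ∀ᵐ x, ‖m x‖ ≤ C) : ‖mulOp m hm‖ ≤ C := by
  refine ContinuousLinearMap.opNorm_le_bound _ hC fun f ↦ ?_
  refine Lp.norm_le_mul_norm_of_ae_le_mul ?_
  filter_upwards [mulOp_coeFn m hm f, h] with x h1 h2
  rw [h1, norm_mul]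
  gcongr

theorem mulOp_sub {m m' : EuclideanSpace ℝ (Fin d) → ℂ} (hm : MemLp m ∞ volume)
    (hm' : MemLp m' ∞ volume) : mulOp m hm - mulOp m' hm' = mulOp (m - m') (hm.sub hm') := by
  ext1 f
  apply Lp.ext
  filter_upwards [mulOp_coeFn m hm f, mulOp_coeFn m' hm' f, mulOp_coeFn _ (hm.sub hm') f,
    Lp.coeFn_sub (mulOp m hm f) (mulOp m' hm' f)] with x h1 h2 h3 h4
  rw [sub_apply, h4, Pi.sub_apply, h1, h2, h3, Pi.sub_apply, sub_mul]

theorem isPositive_mulOp {m : EuclideanSpace ℝ (Fin d) → ℂ} (hm : MemLp m ∞ volume)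
    (h : ∀ x, ∃ r : ℝ, 0 ≤ r ∧ m x = r) : (mulOp m hm).IsPositive := by
  choose r hr0 hr using h
  refine (mulOp m hm).isPositive_def.2 ⟨fun f g ↦ ?_, fun f ↦ ?_⟩
  · rw [ContinuousLinearMap.coe_coe, L2.inner_def, L2.inner_def]
    refine integral_congr_ae ?_
    filter_upwards [mulOp_coeFn m hm f, mulOp_coeFn m hm g] with x h1 h2
    rw [h1, h2, RCLike.inner_apply, RCLike.inner_apply, map_mul, hr, Complex.conj_ofReal]
    ring
  · rw [ContinuousLinearMap.reApplyInnerSelf_apply, L2.inner_def]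
    have hint := L2.integrable_inner (𝕜 := ℂ) (mulOp m hm f) f
    rw [← integral_re hint]
    refine integral_nonneg_of_ae ?_
    filter_upwards [mulOp_coeFn m hm f] with x h1
    have h2 : ⟪(mulOp m hm f) x, f x⟫_ℂ = ((r x * ‖f x‖ ^ 2 : ℝ) : ℂ) := by
      rw [h1, RCLike.inner_apply, map_mul, hr, Complex.conj_ofReal, mul_left_comm, RCLike.mul_conj]
      push_cast
      rfl
    rw [h2]
    exact mul_nonneg (hr0 x) (by positivity)

theorem isPositive_mulSqrt {ρ : EuclideanSpace ℝ (Fin d) → ℝ} (hρ : IsDensity ρ) :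
    (mulSqrt hρ).IsPositive :=
  isPositive_mulOp _ fun x ↦ ⟨√(ρ x), Real.sqrt_nonneg _, rfl⟩

end Multiplication

/-! ### Positivity, norm bounds and monotonicity of the resolvent -/

section Resolvent

variable {d : ℕ} {c : ℝ}

theorem resolventSymbol_eq_ofReal (c κ : ℝ) (ξ : EuclideanSpace ℝ (Fin d)) :
    ((c : ℂ) * symbol ξ + (κ : ℂ))⁻¹ = (((c * (2 * Real.pi * ‖ξ‖) + κ)⁻¹ : ℝ) : ℂ) := by
  simp [symbol]

theorem inner_resolvent (hc : 0 < c) {κ : ℝ} (hκ : 0 < κ) (f g : L2 d) :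
    ⟪resolvent d hc hκ f, g⟫_ℂ =
      ⟪mulOp _ (memLp_resolventSymbol d hc hκ) (fourierL2 d f), fourierL2 d g⟫_ℂ := by
  rw [← (fourierL2 d).inner_map_map, resolvent_apply, LinearIsometryEquiv.apply_symm_apply]

theorem isPositive_resolvent (hc : 0 < c) {κ : ℝ} (hκ : 0 < κ) :
    (resolvent d hc hκ).IsPositive := by
  have hM := isPositive_mulOp (memLp_resolventSymbol d hc hκ) fun ξ ↦
    ⟨_, by positivity, resolventSymbol_eq_ofReal c κ ξ⟩
  refine (resolvent d hc hκ).isPositive_def.2 ⟨fun f g ↦ ?_, fun f ↦ ?_⟩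
  · rw [ContinuousLinearMap.coe_coe, inner_resolvent, ← inner_conj_symm f, inner_resolvent,
      inner_conj_symm]
    exact hM.isSymmetric _ _
  · rw [ContinuousLinearMap.reApplyInnerSelf_apply, inner_resolvent]
    exact hM.re_inner_nonneg_left _

theorem norm_resolvent_le (hc : 0 < c) {κ : ℝ} (hκ : 0 < κ) : ‖resolvent d hc hκ‖ ≤ κ⁻¹ := by
  have hM : ‖mulOp _ (memLp_resolventSymbol d hc hκ)‖ ≤ κ⁻¹ :=
    norm_mulOp_le _ (by positivity) (Filter.Eventually.of_forall fun ξ ↦ by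
      rw [resolventSymbol_eq_ofReal, Complex.norm_real, Real.norm_of_nonneg (by positivity)]
      exact inv_anti₀ hκ (by linarith [show 0 ≤ c * (2 * Real.pi * ‖ξ‖) by positivity]))
  refine ContinuousLinearMap.opNorm_le_bound _ (by positivity) fun f ↦ ?_
  rw [resolvent_apply, LinearIsometryEquiv.norm_map]
  refine (ContinuousLinearMap.le_of_opNorm_le _ hM _).trans ?_
  rw [LinearIsometryEquiv.norm_map]

/-- The resolvent identity on the Fourier side: the symbols differ by `(ν - μ)` over a product of
two factors that are at least `κ`. -/
theorem norm_resolvent_sub_le (hc : 0 < c) {μ ν κ : ℝ} (hκ : 0 < κ) (hμ : κ ≤ μ) (hν : κ ≤ ν) :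
    ‖resolvent d hc (hκ.trans_le hμ) - resolvent d hc (hκ.trans_le hν)‖ ≤
      (κ ^ 2)⁻¹ * |μ - ν| := by
  have hM : ‖mulOp _ (memLp_resolventSymbol d hc (hκ.trans_le hμ)) -
      mulOp _ (memLp_resolventSymbol d hc (hκ.trans_le hν))‖ ≤ (κ ^ 2)⁻¹ * |μ - ν| := by
    rw [mulOp_sub]
    refine norm_mulOp_le _ (by positivity) (Filter.Eventually.of_forall fun ξ ↦ ?_)
    rw [Pi.sub_apply, resolventSymbol_eq_ofReal, resolventSymbol_eq_ofReal, ← Complex.ofReal_sub,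
      Complex.norm_real, Real.norm_eq_abs]
    have h0 : 0 ≤ c * (2 * Real.pi * ‖ξ‖) := by positivity
    have h1 : κ ≤ c * (2 * Real.pi * ‖ξ‖) + μ := by linarith
    have h2 : κ ≤ c * (2 * Real.pi * ‖ξ‖) + ν := by linarith
    have h3 : 0 < c * (2 * Real.pi * ‖ξ‖) + μ := by linarith
    have h4 : 0 < c * (2 * Real.pi * ‖ξ‖) + ν := by linarith
    rw [inv_sub_inv h3.ne' h4.ne', abs_div, abs_of_pos (mul_pos h3 h4), abs_sub_comm μ ν,
      add_sub_add_left_eq_sub, div_eq_inv_mul]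
    gcongr
    nlinarith
  refine ContinuousLinearMap.opNorm_le_bound _ (by positivity) fun f ↦ ?_
  rw [sub_apply, resolvent_apply, resolvent_apply, ← map_sub, LinearIsometryEquiv.norm_map,
    ← sub_apply]
  refine (ContinuousLinearMap.le_of_opNorm_le _ hM _).trans ?_
  rw [LinearIsometryEquiv.norm_map]

theorem re_inner_resolvent_anti (hc : 0 < c) {μ ν : ℝ} (hμ : 0 < μ) (hν : μ ≤ ν) (f : L2 d) :
    (⟪resolvent d hc (hμ.trans_le hν) f, f⟫_ℂ).re ≤ (⟪resolvent d hc hμ f, f⟫_ℂ).re := by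
  rw [inner_resolvent, inner_resolvent, ← sub_nonneg, ← Complex.sub_re, ← inner_sub_left,
    ← sub_apply, mulOp_sub]
  refine (isPositive_mulOp _ fun ξ ↦ ⟨(c * (2 * Real.pi * ‖ξ‖) + μ)⁻¹ -
    (c * (2 * Real.pi * ‖ξ‖) + ν)⁻¹, ?_, ?_⟩).re_inner_nonneg_left _
  · exact sub_nonneg.2 (inv_anti₀ (by positivity) (by linarith))
  · rw [Pi.sub_apply, resolventSymbol_eq_ofReal, resolventSymbol_eq_ofReal, ← Complex.ofReal_sub]

/-- The resolvent `(c(-Δ)^{1/2} + μ)⁻¹` as a function of `μ`, extended by zero to `μ ≤ 0`. -/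
def resolventFamily (d : ℕ) {c : ℝ} (hc : 0 < c) (μ : ℝ) : L2 d →L[ℂ] L2 d :=
  if h : 0 < μ then resolvent d hc h else 0

theorem resolventFamily_of_pos (hc : 0 < c) {μ : ℝ} (hμ : 0 < μ) :
    resolventFamily d hc μ = resolvent d hc hμ := dif_pos hμ

theorem continuousOn_resolventFamily (hc : 0 < c) {κ : ℝ} (hκ : 0 < κ) :
    ContinuousOn (resolventFamily d hc) (Set.Ici κ) := by
  refine (LipschitzOnWith.of_dist_le_mul (K := ⟨(κ ^ 2)⁻¹, by positivity⟩) fun μ hμ ν hν ↦ ?_).continuousOn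
  rw [resolventFamily_of_pos hc (hκ.trans_le hμ), resolventFamily_of_pos hc (hκ.trans_le hν),
    dist_eq_norm, Real.dist_eq]
  exact norm_resolvent_sub_le hc hκ hμ hν

end Resolvent

/-! ### Compactness of `√ρ (c(-Δ)^{1/2} + κ)⁻¹` -/

section Compactness

variable {d : ℕ}

/-- An operator whose values at the points of a compact set are controlled by inner products with
a continuous family of vectors, and vanish elsewhere, is compact. -/
theorem isCompactOperator_of_norm_apply_le {T : L2 d →L[ℂ] L2 d}
    {S : Set (EuclideanSpace ℝ (Fin d))} (hS : IsCompact S)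
    {e : EuclideanSpace ℝ (Fin d) → L2 d} (he : ContinuousOn e S) {C : ℝ} (hC : 0 ≤ C)
    (h : ∀ f, ∀ᵐ x, ‖T f x‖ ≤ C * S.indicator (fun x ↦ ‖⟪e x, f⟫_ℂ‖) x) :
    IsCompactOperator T := by
  have hvol : volume S ≠ ∞ := hS.measure_ne_top
  let χ : L2 d := indicatorConstLp 2 hS.measurableSet hvol 1
  refine isClosed_setOfPred_isCompactOperator.closure_subset (Metric.mem_closure_iff.2 fun ε hε ↦ ?_)
  obtain ⟨δ, hδ, hδε⟩ : ∃ δ > 0, C * δ * ‖χ‖ < ε := by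
    refine ⟨ε / (C * ‖χ‖ + 1), by positivity, ?_⟩
    have : C * (ε / (C * ‖χ‖ + 1)) * ‖χ‖ = ε * ((C * ‖χ‖) / (C * ‖χ‖ + 1)) := by ring
    rw [this]
    refine mul_lt_of_lt_one_right hε ((div_lt_one (by positivity)).2 (lt_add_one _))
  -- The image of `S` under `e` is totally bounded. Projecting onto the span of the centres of a
  -- finite `δ`-cover changes `T` by at most `C * δ * ‖χ‖`, where `‖χ‖` is the square root of the
  -- volume of `S`.
  obtain ⟨t, -, htfin, ht⟩ := (hS.image_of_continuousOn he).finite_cover_balls hδ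
  let V := Submodule.span ℂ t
  have hV : FiniteDimensional ℂ V := FiniteDimensional.span_of_finite ℂ htfin
  let P : L2 d →L[ℂ] V := V.orthogonalProjectionOnto
  have hPc : IsCompactOperator P := by
    have : ProperSpace V := FiniteDimensional.proper ℂ V
    exact isCompactOperator_of_locallyCompactSpace_dom P
  refine ⟨T ∘L V.subtypeL ∘L P, hPc.clm_comp (T ∘L V.subtypeL), ?_⟩
  rw [dist_eq_norm]
  refine lt_of_le_of_lt (ContinuousLinearMap.opNorm_le_bound _ (by positivity) fun f ↦ ?_) hδε
  have hker : ∀ x ∈ S, ‖⟪e x, f - P f⟫_ℂ‖ ≤ δ * ‖f‖ := fun x hx ↦ by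
    obtain ⟨v, hv, hxv⟩ := Set.mem_iUnion₂.1 (ht (Set.mem_image_of_mem e hx))
    have h0 : ⟪v, f - P f⟫_ℂ = 0 := V.sub_starProjection_mem_orthogonal f v (Submodule.subset_span hv)
    have h1 : ⟪e x, f - P f⟫_ℂ = ⟪e x - v, f - P f⟫_ℂ := by rw [inner_sub_left, h0, sub_zero]
    have h2 : ‖f - P f‖ ≤ ‖f‖ := by
      have : f - P f = Vᗮ.starProjection f := by
        rw [Submodule.starProjection_orthogonal_val]; rfl
      rw [this]
      exact Vᗮ.norm_starProjection_apply_le f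
    rw [h1]
    calc _ ≤ ‖e x - v‖ * ‖f - P f‖ := norm_inner_le_norm _ _
      _ ≤ δ * ‖f‖ := by
        gcongr
        exact (mem_ball_iff_norm.1 hxv).le
  have hsub : (T - T ∘L V.subtypeL ∘L P) f = T (f - P f) := by
    rw [map_sub]; rfl
  rw [hsub]
  calc ‖T (f - P f)‖ ≤ (C * δ * ‖f‖) * ‖χ‖ := by
        refine Lp.norm_le_mul_norm_of_ae_le_mul ?_
        filter_upwards [h (f - P f), indicatorConstLp_coeFn (p := 2) (hs := hS.measurableSet)
          (hμs := hvol) (c := (1 : ℂ))] with x h1 h2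
        refine h1.trans ?_
        rw [h2]
        by_cases hx : x ∈ S
        · rw [Set.indicator_of_mem hx, Set.indicator_of_mem hx, norm_one, mul_one, mul_assoc]
          gcongr
          exact hker x hx
        · rw [Set.indicator_of_notMem hx, Set.indicator_of_notMem hx]
          simp
    _ = _ := by ring

/-- The `L²` inverse Fourier transform of an integrable function is given by the integral. -/
theorem fourierL2_symm_ae_eq (h : L2 d) (hi : Integrable h) :
    (fourierL2 d).symm h =ᵐ[volume] fun x ↦ ∫ ξ, 𝐞 (inner ℝ ξ x) • h ξ := by
  -- The minus sign makes `fourierIntegral` for `L` the inverse transform; `L` is symmetric.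
  let L : EuclideanSpace ℝ (Fin d) →ₗ[ℝ] EuclideanSpace ℝ (Fin d) →ₗ[ℝ] ℝ :=
    -innerₗ (EuclideanSpace ℝ (Fin d))
  have hL : Continuous fun p : EuclideanSpace ℝ (Fin d) × EuclideanSpace ℝ (Fin d) ↦ L p.1 p.2 := by
    change Continuous fun p : EuclideanSpace ℝ (Fin d) × EuclideanSpace ℝ (Fin d) ↦
      -(inner ℝ p.1 p.2)
    fun_prop
  have hflip : L.flip = L := by
    ext x y
    exact congrArg Neg.neg (real_inner_comm x y)
  have hrhs : (fun x ↦ ∫ ξ, 𝐞 (inner ℝ ξ x) • h ξ) =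
      VectorFourier.fourierIntegral 𝐞 volume L h := by
    funext x
    simp [VectorFourier.fourierIntegral, L]
  rw [hrhs]
  -- Against a test function, the distributional definition moves the inverse transform onto the
  -- test function, and Fubini moves it back onto `h` as an integral.
  refine ae_eq_of_integral_contDiff_smul_eq ((Lp.memLp _).locallyIntegrable (by norm_num))
    (VectorFourier.fourierIntegral_continuous Real.continuous_fourierChar hL hi).locallyIntegrable
    fun g g_smooth g_cpt ↦ ?_
  have hg₁ : HasCompactSupport (Complex.ofRealCLM ∘ g) := g_cpt.comp_left rfl
  have hg₂ : ContDiff ℝ ((⊤ : ℕ∞) : WithTop ℕ∞) (Complex.ofRealCLM ∘ g) := by fun_prop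
  let G := hg₁.toSchwartzMap hg₂
  have h1 := congrArg (fun D ↦ D G) (Lp.fourierInv_toTemperedDistribution_eq h)
  simp only [TemperedDistribution.fourierInv_apply, Lp.toTemperedDistribution_apply] at h1
  have h2 := VectorFourier.integral_fourierIntegral_smul_eq_flip (μ := volume) (ν := volume)
    (L := L) Real.continuous_fourierChar hL (SchwartzMap.integrable G) hi
  rw [hflip] at h2
  calc ∫ x, g x • ((fourierL2 d).symm h) x = ∫ x, G x • (𝓕⁻ h : L2 d) x := rfl
    _ = ∫ ξ, (𝓕⁻ G) ξ • h ξ := h1.symm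
    _ = ∫ ξ, VectorFourier.fourierIntegral 𝐞 volume L G ξ • h ξ := by
      congr 1
      funext ξ
      rw [SchwartzMap.fourierInv_coe, Real.fourierInv_eq]
      simp [VectorFourier.fourierIntegral, L]
    _ = _ := h2

theorem memLp_indicator_one {B : Set (EuclideanSpace ℝ (Fin d))} (hB : MeasurableSet B) :
    MemLp (B.indicator fun _ ↦ (1 : ℂ)) ∞ volume :=
  memLp_top_of_bound ((measurable_const.indicator hB).aestronglyMeasurable) 1
    (Filter.Eventually.of_forall fun x ↦ by
      by_cases hx : x ∈ B <;> simp [hx])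

/-- The function `ξ ↦ exp(-2πi x·ξ)` on `B`, extended by zero. -/
def planeWave (B : Set (EuclideanSpace ℝ (Fin d))) (x : EuclideanSpace ℝ (Fin d)) :
    EuclideanSpace ℝ (Fin d) → ℂ :=
  B.indicator fun ξ ↦ ((𝐞 (-(inner ℝ ξ x)) : Circle) : ℂ)

theorem memLp_planeWave {B : Set (EuclideanSpace ℝ (Fin d))} (hB : MeasurableSet B)
    (hvol : volume B ≠ ∞) (x : EuclideanSpace ℝ (Fin d)) : MemLp (planeWave B x) 2 volume := by
  refine (memLp_indicator_const 2 hB (1 : ℂ) (Or.inr hvol)).mono ?_ ?_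
  · refine Measurable.aestronglyMeasurable (Measurable.indicator ?_ hB)
    exact Continuous.measurable (by fun_prop)
  · exact Filter.Eventually.of_forall fun ξ ↦ by
      by_cases hξ : ξ ∈ B
      · rw [planeWave, Set.indicator_of_mem hξ, Set.indicator_of_mem hξ, Circle.norm_coe, norm_one]
      · simp [planeWave, hξ]

/-- On the ball the phases at `x` and `y` differ by at most `2πR‖x - y‖`, whence a Lipschitz bound
in `L²`. -/
theorem continuous_toLp_planeWave {R : ℝ} (hR : 0 ≤ R) :
    Continuous fun x : EuclideanSpace ℝ (Fin d) ↦
      (memLp_planeWave (measurableSet_closedBall (x := 0) (ε := R))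
        measure_closedBall_lt_top.ne x).toLp := by
  have hvol : volume (Metric.closedBall (0 : EuclideanSpace ℝ (Fin d)) R) ≠ ∞ :=
    measure_closedBall_lt_top.ne
  let χ : L2 d := indicatorConstLp 2 measurableSet_closedBall hvol 1
  refine (LipschitzWith.of_dist_le_mul (K := ⟨2 * Real.pi * R * ‖χ‖, by positivity⟩)
    fun x y ↦ ?_).continuous
  rw [dist_eq_norm, dist_eq_norm]
  calc _ ≤ (2 * Real.pi * R * ‖x - y‖) * ‖χ‖ := ?_
    _ = 2 * Real.pi * R * ‖χ‖ * ‖x - y‖ := by ring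
  refine Lp.norm_le_mul_norm_of_ae_le_mul ?_
  filter_upwards [Lp.coeFn_sub (memLp_planeWave measurableSet_closedBall hvol x).toLp
    (memLp_planeWave measurableSet_closedBall hvol y).toLp,
    (memLp_planeWave measurableSet_closedBall hvol x).coeFn_toLp,
    (memLp_planeWave measurableSet_closedBall hvol y).coeFn_toLp,
    indicatorConstLp_coeFn (p := 2) (hs := measurableSet_closedBall) (hμs := hvol) (c := (1 : ℂ))]
    with ξ h1 h2 h3 h4
  rw [h1, Pi.sub_apply, h2, h3, h4, planeWave, planeWave]
  by_cases hξ : ξ ∈ Metric.closedBall (0 : EuclideanSpace ℝ (Fin d)) R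
  · rw [Set.indicator_of_mem hξ, Set.indicator_of_mem hξ, Set.indicator_of_mem hξ, norm_one, mul_one,
      Real.fourierChar_apply, Real.fourierChar_apply]
    have hle : ‖ξ‖ ≤ R := by simpa using hξ
    have e : Complex.exp (↑(2 * Real.pi * -(inner ℝ ξ x)) * Complex.I) -
        Complex.exp (↑(2 * Real.pi * -(inner ℝ ξ y)) * Complex.I) =
        Complex.exp (↑(2 * Real.pi * -(inner ℝ ξ y)) * Complex.I) *
        (Complex.exp (Complex.I * ↑(2 * Real.pi * -(inner ℝ ξ (x - y)))) - 1) := by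
      rw [mul_sub, ← Complex.exp_add, mul_one, inner_sub_right]
      congr 2
      push_cast
      ring
    rw [e, norm_mul, Complex.norm_exp_ofReal_mul_I, one_mul]
    refine (Real.norm_exp_I_mul_ofReal_sub_one_le).trans ?_
    rw [Real.norm_eq_abs, abs_mul, abs_neg, abs_of_pos (by positivity : 0 < 2 * Real.pi)]
    have hin : |(inner ℝ ξ (x - y))| ≤ R * ‖x - y‖ :=
      (abs_real_inner_le_norm ξ (x - y)).trans (by gcongr)
    calc 2 * Real.pi * |(inner ℝ ξ (x - y))| ≤ 2 * Real.pi * (R * ‖x - y‖) := by gcongr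
      _ = _ := (mul_assoc _ _ _).symm
  · rw [Set.indicator_of_notMem hξ, Set.indicator_of_notMem hξ, Set.indicator_of_notMem hξ]
    simp

/-- After the frequency cutoff the function is integrable, so its inverse transform at `x` is an
inner product with a truncated plane wave; `√ρ` is bounded and confines `x` to a compact set. -/
theorem isCompactOperator_mulSqrt_fourierL2_symm_indicator
    {ρ : EuclideanSpace ℝ (Fin d) → ℝ} (hρ : IsDensity ρ) {R : ℝ} (hR : 0 ≤ R) :
    IsCompactOperator (mulSqrt hρ ∘L
      (fourierL2 d).symm.toContinuousLinearEquiv.toContinuousLinearMap ∘L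
        mulOp _ (memLp_indicator_one (measurableSet_closedBall (x := 0) (ε := R)))) := by
  have hvol : volume (Metric.closedBall (0 : EuclideanSpace ℝ (Fin d)) R) ≠ ∞ :=
    measure_closedBall_lt_top.ne
  obtain ⟨S, hS, hSρ⟩ := hρ.compactSupport
  set C := (eLpNormEssSup (fun x ↦ ((√(ρ x) : ℝ) : ℂ)) volume).toReal
  have hC : ∀ᵐ x, ‖((√(ρ x) : ℝ) : ℂ)‖ ≤ C := by
    have hlt : eLpNormEssSup (fun x ↦ ((√(ρ x) : ℝ) : ℂ)) volume ≠ ∞ := by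
      simpa using hρ.memLp_sqrt.2.ne
    filter_upwards [enorm_ae_le_eLpNormEssSup (fun x ↦ ((√(ρ x) : ℝ) : ℂ)) volume] with x hx
    rw [← toReal_enorm]
    exact ENNReal.toReal_mono hlt hx
  refine isCompactOperator_of_norm_apply_le hS (C := C)
    (continuous_toLp_planeWave hR).continuousOn ENNReal.toReal_nonneg fun f ↦ ?_
  set h : L2 d := mulOp _ (memLp_indicator_one (measurableSet_closedBall (x := 0) (ε := R))) f
  have hh : h =ᵐ[volume] fun ξ ↦ (Metric.closedBall 0 R).indicator (fun _ ↦ (1 : ℂ)) ξ * f ξ :=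
    mulOp_coeFn _ _ f
  have hi : Integrable h := by
    have : IsFiniteMeasure (volume.restrict
        (Metric.closedBall (0 : EuclideanSpace ℝ (Fin d)) R)) :=
      isFiniteMeasure_restrict.2 hvol
    have h1 : Integrable ((Metric.closedBall (0 : EuclideanSpace ℝ (Fin d)) R).indicator f) :=
      (integrable_indicator_iff measurableSet_closedBall).2
        (((Lp.memLp f).restrict _).integrable (by norm_num))
    refine h1.congr ?_
    filter_upwards [hh] with ξ hξ
    rw [hξ]
    by_cases hm : ξ ∈ Metric.closedBall (0 : EuclideanSpace ℝ (Fin d)) R <;> simp [hm]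
  filter_upwards [hC, hSρ, mulOp_coeFn _ hρ.memLp_sqrt ((fourierL2 d).symm h),
    fourierL2_symm_ae_eq h hi] with x hx1 hx2 hx3 hx4
  change ‖(mulOp _ hρ.memLp_sqrt ((fourierL2 d).symm h)) x‖ ≤ _
  rw [hx3, hx4, norm_mul]
  by_cases hxS : x ∈ S
  · rw [Set.indicator_of_mem hxS, L2.inner_def]
    refine mul_le_mul hx1 (le_of_eq (congrArg norm (integral_congr_ae ?_))) (norm_nonneg _)
      ENNReal.toReal_nonneg
    filter_upwards [hh, (memLp_planeWave measurableSet_closedBall hvol x).coeFn_toLp] with ξ h1 h2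
    rw [h1, h2, planeWave, RCLike.inner_apply]
    by_cases hm : ξ ∈ Metric.closedBall (0 : EuclideanSpace ℝ (Fin d)) R
    · rw [Set.indicator_of_mem hm, Set.indicator_of_mem hm, one_mul, Circle.smul_def, smul_eq_mul,
        mul_comm, AddChar.map_neg_eq_inv, Circle.coe_inv_eq_conj, Complex.conj_conj]
    · rw [Set.indicator_of_notMem hm, Set.indicator_of_notMem hm]
      simp
  · rw [hx2 hxS, Set.indicator_of_notMem hxS]
    simp

/-- Discarding frequencies above `R` costs at most `‖√ρ‖ / (2πcR)` in norm, and norm limits of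
compact operators are compact. -/
theorem isCompactOperator_mulSqrt_resolvent {c : ℝ} (hc : 0 < c)
    {ρ : EuclideanSpace ℝ (Fin d) → ℝ} (hρ : IsDensity ρ) {κ : ℝ} (hκ : 0 < κ) :
    IsCompactOperator (mulSqrt hρ ∘L resolvent d hc hκ) := by
  refine isClosed_setOfPred_isCompactOperator.closure_subset (Metric.mem_closure_iff.2 fun ε hε ↦ ?_)
  obtain ⟨R, hR, hRε⟩ : ∃ R > 0, ‖mulSqrt hρ‖ * (c * (2 * Real.pi * R))⁻¹ < ε := by
    refine ⟨(‖mulSqrt hρ‖ + 1) / (c * (2 * Real.pi) * ε), by positivity, ?_⟩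
    have : ‖mulSqrt hρ‖ * (c * (2 * Real.pi * ((‖mulSqrt hρ‖ + 1) / (c * (2 * Real.pi) * ε))))⁻¹ =
        ε * (‖mulSqrt hρ‖ / (‖mulSqrt hρ‖ + 1)) := by
      field_simp
    rw [this]
    exact mul_lt_of_lt_one_right hε ((div_lt_one (by positivity)).2 (lt_add_one _))
  set M := mulOp _ (memLp_resolventSymbol d hc hκ)
  set X := mulOp _ (memLp_indicator_one
    (measurableSet_closedBall (x := (0 : EuclideanSpace ℝ (Fin d))) (ε := R)))
  have hle : ∀ f, ‖M f - X (M f)‖ ≤ (c * (2 * Real.pi * R))⁻¹ * ‖f‖ := fun f ↦ by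
    refine Lp.norm_le_mul_norm_of_ae_le_mul ?_
    filter_upwards [Lp.coeFn_sub (M f) (X (M f)), mulOp_coeFn _ (memLp_resolventSymbol d hc hκ) f,
      mulOp_coeFn _ (memLp_indicator_one
        (measurableSet_closedBall (x := (0 : EuclideanSpace ℝ (Fin d))) (ε := R))) (M f)]
      with ξ h1 h2 h3
    rw [h1, Pi.sub_apply, h3, h2]
    by_cases hm : ξ ∈ Metric.closedBall (0 : EuclideanSpace ℝ (Fin d)) R
    · rw [Set.indicator_of_mem hm, one_mul, sub_self, norm_zero]
      positivity
    · have hlt : R < ‖ξ‖ := by simpa using hm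
      rw [Set.indicator_of_notMem hm, zero_mul, sub_zero, norm_mul, resolventSymbol_eq_ofReal,
        Complex.norm_real, Real.norm_of_nonneg (by positivity)]
      gcongr
      have : c * (2 * Real.pi * R) ≤ c * (2 * Real.pi * ‖ξ‖) := by gcongr
      linarith
  let U := (fourierL2 d).toContinuousLinearEquiv.toContinuousLinearMap
  let U' := (fourierL2 d).symm.toContinuousLinearEquiv.toContinuousLinearMap
  refine ⟨(mulSqrt hρ ∘L U' ∘L X) ∘L (M ∘L U),
    (isCompactOperator_mulSqrt_fourierL2_symm_indicator hρ hR.le).comp_clm (M ∘L U), ?_⟩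
  rw [dist_eq_norm]
  refine lt_of_le_of_lt (ContinuousLinearMap.opNorm_le_bound _ (by positivity) fun f ↦ ?_) hRε
  have e : (mulSqrt hρ ∘L resolvent d hc hκ - (mulSqrt hρ ∘L U' ∘L X) ∘L (M ∘L U)) f =
      mulSqrt hρ ((fourierL2 d).symm (M (fourierL2 d f) - X (M (fourierL2 d f)))) := by
    rw [map_sub, map_sub]
    rfl
  rw [e, mul_assoc]
  refine (ContinuousLinearMap.le_opNorm _ _).trans ?_
  gcongr
  rw [LinearIsometryEquiv.norm_map]
  refine (hle _).trans ?_
  rw [LinearIsometryEquiv.norm_map]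

end Compactness

/-! ### The Birman-Schwinger family and the eigenvectors of `H` -/

section Family

variable {d : ℕ} {c : ℝ} (hc : 0 < c) (g Ω : ℝ) {ρ : EuclideanSpace ℝ (Fin d) → ℝ}
  (hρ : IsDensity ρ)

/-- The Birman-Schwinger operator as a function of `μ = |ω|`. -/
def birmanSchwingerFamily (μ : ℝ) : L2 d →L[ℂ] L2 d :=
  ((g ^ 2 / (Ω + μ) : ℝ) : ℂ) • (mulSqrt hρ ∘L resolventFamily d hc μ ∘L mulSqrt hρ)

theorem birmanSchwingerOp_eq_family {ω : ℝ} (hω : ω < 0) :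
    birmanSchwingerOp hc g Ω hρ hω = birmanSchwingerFamily hc g Ω hρ |ω| := by
  rw [birmanSchwingerFamily, resolventFamily_of_pos hc (abs_pos.2 hω.ne)]
  rfl

theorem isPositive_birmanSchwingerFamily (hΩ : 0 < Ω) {μ : ℝ} (hμ : 0 < μ) :
    (birmanSchwingerFamily hc g Ω hρ μ).IsPositive := by
  rw [birmanSchwingerFamily, resolventFamily_of_pos hc hμ]
  have h := (isPositive_resolvent hc hμ).conj_adjoint (mulSqrt hρ)
  rw [(isPositive_mulSqrt hρ).isSelfAdjoint.adjoint_eq] at h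
  have h0 : 0 ≤ g ^ 2 / (Ω + μ) := by positivity
  exact h.smul_of_nonneg (RCLike.ofReal_nonneg.2 h0)

theorem isCompactOperator_birmanSchwingerFamily {μ : ℝ} (hμ : 0 < μ) :
    IsCompactOperator (birmanSchwingerFamily hc g Ω hρ μ) := by
  rw [birmanSchwingerFamily, resolventFamily_of_pos hc hμ]
  exact ((isCompactOperator_mulSqrt_resolvent hc hρ hμ).comp_clm (mulSqrt hρ)).smul
    ((g ^ 2 / (Ω + μ) : ℝ) : ℂ)

theorem continuousOn_birmanSchwingerFamily (hΩ : 0 < Ω) {κ : ℝ} (hκ : 0 < κ) :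
    ContinuousOn (birmanSchwingerFamily hc g Ω hρ) (Set.Ici κ) := by
  have h1 : ContinuousOn (fun μ : ℝ ↦ ((g ^ 2 / (Ω + μ) : ℝ) : ℂ)) (Set.Ici κ) := by
    refine Complex.continuous_ofReal.comp_continuousOn (continuousOn_const.div (by fun_prop) ?_)
    intro μ hμ
    have : κ ≤ μ := hμ
    exact (by linarith : 0 < Ω + μ).ne'
  exact h1.smul (continuousOn_const.clm_comp
    ((continuousOn_resolventFamily hc hκ).clm_comp continuousOn_const))

theorem re_inner_birmanSchwingerFamily {μ : ℝ} (hμ : 0 < μ) (f : L2 d) :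
    (⟪birmanSchwingerFamily hc g Ω hρ μ f, f⟫_ℂ).re =
      g ^ 2 / (Ω + μ) * (⟪resolvent d hc hμ (mulSqrt hρ f), mulSqrt hρ f⟫_ℂ).re := by
  rw [birmanSchwingerFamily, resolventFamily_of_pos hc hμ, smul_apply, inner_smul_left,
    Complex.conj_ofReal, Complex.re_ofReal_mul, ContinuousLinearMap.comp_apply,
    ContinuousLinearMap.comp_apply, (isPositive_mulSqrt hρ).inner_left_eq_inner_right]

/-- Strictness comes from the prefactor `g ^ 2 / (Ω + μ)` alone; the resolvent form need only be
nonincreasing. Positivity of the form at `ν` ensures that neither `g` nor the resolvent form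
vanishes. -/
theorem re_inner_birmanSchwingerFamily_lt (hΩ : 0 < Ω) {μ ν : ℝ} (hμ : 0 < μ) (hν : μ < ν)
    (f : L2 d) (hf : 0 < (⟪birmanSchwingerFamily hc g Ω hρ ν f, f⟫_ℂ).re) :
    (⟪birmanSchwingerFamily hc g Ω hρ ν f, f⟫_ℂ).re <
      (⟪birmanSchwingerFamily hc g Ω hρ μ f, f⟫_ℂ).re := by
  rw [re_inner_birmanSchwingerFamily hc g Ω hρ (hμ.trans hν)] at hf ⊢
  rw [re_inner_birmanSchwingerFamily hc g Ω hρ hμ]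
  have h1 := re_inner_resolvent_anti hc hμ hν.le (mulSqrt hρ f)
  have hν0 : 0 < ν := hμ.trans hν
  have hq : 0 < (⟪resolvent d hc hν0 (mulSqrt hρ f), mulSqrt hρ f⟫_ℂ).re :=
    pos_of_mul_pos_right hf (by positivity)
  have hg : 0 < g ^ 2 := by
    refine lt_of_le_of_ne (by positivity) fun h ↦ ?_
    rw [← h, zero_div, zero_mul] at hf
    exact lt_irrefl _ hf
  refine mul_lt_mul (div_lt_div_of_pos_left hg (by positivity) (by linarith)) h1 hq (by positivity)

theorem exists_norm_birmanSchwingerFamily_lt_one (hΩ : 0 < Ω) :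
    ∃ M, ∀ ν, M ≤ ν → ‖birmanSchwingerFamily hc g Ω hρ ν‖ < 1 := by
  -- For `ν ≥ 1` the resolvent has norm at most `1`; the second bound gives a quotient below `1`
  -- because `Ω > 0`.
  refine ⟨max 1 (g ^ 2 * ‖mulSqrt hρ‖ ^ 2), fun ν hν ↦ ?_⟩
  have hν1 : 1 ≤ ν := (le_max_left _ _).trans hν
  have hν2 : g ^ 2 * ‖mulSqrt hρ‖ ^ 2 ≤ ν := (le_max_right _ _).trans hν
  have hν0 : 0 < ν := by linarith
  rw [birmanSchwingerFamily, resolventFamily_of_pos hc hν0, norm_smul, Complex.norm_real,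
    Real.norm_of_nonneg (by positivity)]
  have h1 : ‖mulSqrt hρ ∘L resolvent d hc hν0 ∘L mulSqrt hρ‖ ≤
      ‖mulSqrt hρ‖ * (1 * ‖mulSqrt hρ‖) := by
    refine (ContinuousLinearMap.opNorm_comp_le _ _).trans ?_
    gcongr
    refine (ContinuousLinearMap.opNorm_comp_le _ _).trans ?_
    gcongr
    exact (norm_resolvent_le hc hν0).trans (inv_le_one_of_one_le₀ hν1)
  calc _ ≤ g ^ 2 / (Ω + ν) * (‖mulSqrt hρ‖ * (1 * ‖mulSqrt hρ‖)) := by gcongr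
    _ = (g ^ 2 * ‖mulSqrt hρ‖ ^ 2) / (Ω + ν) := by ring
    _ < 1 := (div_lt_one (by positivity)).2 (by linarith)

/-- The first row is solved for `u.fst` with the resolvent, which also accounts for the domain
condition; substitution into the second row and division by `Ω + μ ≠ 0` give the fixed-point
equation. -/
theorem mem_eigenspace_hamiltonian_iff (hΩ : 0 < Ω) {μ : ℝ} (hμ : 0 < μ) (u : State d) :
    u ∈ eigenspace (hamiltonian c g Ω hρ) ((-μ : ℝ) : ℂ) ↔
      u.fst = -(g : ℂ) • resolvent d hc hμ (mulSqrt hρ u.snd) ∧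
        birmanSchwingerFamily hc g Ω hρ μ u.snd = u.snd := by
  have hne : ((Ω + μ : ℝ) : ℂ) ≠ 0 := Complex.ofReal_ne_zero.2 (by positivity)
  have h1 : u ∈ eigenspace (hamiltonian c g Ω hρ) ((-μ : ℝ) : ℂ) ↔
      resolvent d hc hμ (-(g : ℂ) • mulSqrt hρ u.snd) = u.fst ∧
        (g : ℂ) • mulSqrt hρ u.fst = -((Ω + μ : ℝ) : ℂ) • u.snd := by
    rw [resolvent_eq_iff]
    have hsnd : ∀ v w : L2 d, w + (Ω : ℂ) • v = ((-μ : ℝ) : ℂ) • v ↔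
        w = -((Ω + μ : ℝ) : ℂ) • v := fun v w ↦ by
      rw [← eq_sub_iff_add_eq, ← sub_smul]
      push_cast
      rw [show -(μ : ℂ) - Ω = -(Ω + μ) by ring]
    have hfst : ∀ v w z : L2 d, w + z = ((-μ : ℝ) : ℂ) • v ↔ w + (μ : ℂ) • v = -z :=
      fun v w z ↦ by
        rw [Complex.ofReal_neg, neg_smul, eq_neg_iff_add_eq_zero, eq_neg_iff_add_eq_zero,
          add_right_comm]
    constructor
    · rintro ⟨hu, he⟩
      have e1 : (c : ℂ) • sqrtLaplacian d ⟨u.fst, hu.1⟩ + (g : ℂ) • mulSqrt hρ u.snd =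
        ((-μ : ℝ) : ℂ) • u.fst := congrArg WithLp.fst he
      have e2 : (g : ℂ) • mulSqrt hρ u.fst + (Ω : ℂ) • u.snd = ((-μ : ℝ) : ℂ) • u.snd :=
        congrArg WithLp.snd he
      exact ⟨⟨hu.1, by rw [neg_smul]; exact (hfst _ _ _).1 e1⟩, (hsnd _ _).1 e2⟩
    · rintro ⟨⟨hu, e1⟩, e2⟩
      rw [neg_smul] at e1
      refine ⟨⟨hu, trivial⟩, ?_⟩
      exact congrArg (WithLp.toLp 2) (Prod.ext ((hfst _ _ _).2 e1) ((hsnd _ _).2 e2))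
  rw [h1, map_smul, eq_comm]
  refine and_congr_right fun hfst ↦ ?_
  rw [hfst, birmanSchwingerFamily, resolventFamily_of_pos hc hμ, map_smul, neg_smul, smul_neg,
    neg_smul, neg_inj, smul_smul, smul_apply, ContinuousLinearMap.comp_apply,
    ContinuousLinearMap.comp_apply, ← pow_two, Complex.ofReal_div, div_eq_inv_mul, mul_smul,
    inv_smul_eq_iff₀ hne, Complex.ofReal_pow]

/-- The second component determines the first, so projecting onto it is an isomorphism of
eigenspaces. -/
theorem rank_eigenspace_hamiltonian (hΩ : 0 < Ω) {μ : ℝ} (hμ : 0 < μ) :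
    Module.rank ℂ (eigenspace (hamiltonian c g Ω hρ) ((-μ : ℝ) : ℂ)) =
      Module.rank ℂ (Module.End.eigenspace
        (birmanSchwingerFamily hc g Ω hρ μ : L2 d →ₗ[ℂ] L2 d) 1) := by
  have hmem := mem_eigenspace_hamiltonian_iff hc g Ω hρ hΩ hμ
  refine LinearEquiv.rank_eq
    { toFun := fun u ↦ ⟨u.1.snd, Module.End.mem_eigenspace_iff.2 (by
        rw [one_smul]; exact ((hmem u.1).1 u.2).2)⟩
      map_add' := fun _ _ ↦ rfl
      map_smul' := fun _ _ ↦ rfl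
      invFun := fun φ ↦ ⟨WithLp.toLp 2 (-(g : ℂ) • resolvent d hc hμ (mulSqrt hρ φ.1), φ.1),
        (hmem _).2 ⟨rfl, by simpa using Module.End.mem_eigenspace_iff.1 φ.2⟩⟩
      left_inv := fun u ↦ Subtype.ext
        (congrArg (WithLp.toLp 2) (Prod.ext ((hmem u.1).1 u.2).1.symm rfl))
      right_inv := fun _ ↦ rfl }

end Family

/-! ### Translation to eigenvalue counts -/

theorem eigenspace_everywhereDefined {V : Type*} [NormedAddCommGroup V] [NormedSpace ℂ V]
    (T : V →L[ℂ] V) (z : ℂ) :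
    eigenspace (everywhereDefined T) z = Module.End.eigenspace (T : V →ₗ[ℂ] V) z := by
  ext u
  rw [Module.End.mem_eigenspace_iff]
  exact ⟨fun ⟨_, h⟩ ↦ h, fun h ↦ ⟨trivial, h⟩⟩

theorem eigenvalueCount_everywhereDefined {E : Type} [NormedAddCommGroup E] [InnerProductSpace ℂ E]
    {T : E →L[ℂ] E} (hT : T.IsSymmetric) (I : Set ℝ) :
    eigenvalueCount (everywhereDefined T) I = Module.rank ℂ (spectralSubspace T I) := by
  rw [← Cardinal.lift_id (Module.rank ℂ (spectralSubspace T I)), ← cardinal_sum_rank_eigenspace hT,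
    eigenvalueCount]
  congr 1
  funext x
  rw [eigenspace_everywhereDefined]

theorem eigenvalueCount_hamiltonian {d : ℕ} {c : ℝ} (hc : 0 < c) (g Ω : ℝ)
    {ρ : EuclideanSpace ℝ (Fin d) → ℝ} (hρ : IsDensity ρ) (hΩ : 0 < Ω) {ω : ℝ} (hω : ω < 0) :
    eigenvalueCount (hamiltonian c g Ω hρ) (Set.Iic ω) =
      Cardinal.sum (fun μ : Set.Ici |ω| ↦ Module.rank ℂ (Module.End.eigenspace
        (birmanSchwingerFamily hc g Ω hρ μ : L2 d →ₗ[ℂ] L2 d) 1)) := by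
  let e : Set.Ici |ω| ≃ Set.Iic ω :=
    { toFun := fun μ ↦ ⟨-μ.1, by
        exact Set.mem_Iic.2 (by linarith [Set.mem_Ici.1 μ.2, abs_of_neg hω])⟩
      invFun := fun x ↦ ⟨-x.1, by
        exact Set.mem_Ici.2 (by linarith [Set.mem_Iic.1 x.2, abs_of_neg hω])⟩
      left_inv := fun μ ↦ Subtype.ext (neg_neg _)
      right_inv := fun μ ↦ Subtype.ext (neg_neg _) }
  calc _ = Cardinal.sum (fun μ : Set.Ici |ω| ↦
        Module.rank ℂ (eigenspace (hamiltonian c g Ω hρ) ((e μ : ℝ) : ℂ))) :=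
        -- A cardinal sum is the cardinality of a sigma type of representatives, so it can be
        -- reindexed along `μ ↦ -μ`.
        (Cardinal.mk_congr (Equiv.sigmaCongrLeft (β := fun x : Set.Iic ω ↦
          (Module.rank ℂ (eigenspace (hamiltonian c g Ω hρ) ((x : ℝ) : ℂ))).out) e)).symm
    _ = _ := by
      congr 1
      funext μ
      exact rank_eigenspace_hamiltonian hc g Ω hρ hΩ ((abs_pos.2 hω.ne).trans_le μ.2)

end BirmanSchwinger

end

theorem theorem2p3 (d : ℕ) (hd : 1 ≤ d) (c g Ω : ℝ) (hc : 0 < c) (hΩ : 0 < Ω)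
    (ρ : EuclideanSpace ℝ (Fin d) → ℝ) (hρ : BirmanSchwinger.IsDensity ρ)
    (ω : ℝ) (hω : ω < 0) :
    IsSelfAdjoint (BirmanSchwinger.birmanSchwingerOp hc g Ω hρ hω) ∧
    IsCompactOperator (BirmanSchwinger.birmanSchwingerOp hc g Ω hρ hω) ∧
    BirmanSchwinger.eigenvalueCount (BirmanSchwinger.everywhereDefined
      (BirmanSchwinger.birmanSchwingerOp hc g Ω hρ hω)) (Set.Ici 1) < Cardinal.aleph0 ∧
    BirmanSchwinger.eigenvalueCount (BirmanSchwinger.hamiltonian c g Ω hρ) (Set.Iic ω) =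
      BirmanSchwinger.eigenvalueCount (BirmanSchwinger.everywhereDefined
        (BirmanSchwinger.birmanSchwingerOp hc g Ω hρ hω)) (Set.Ici 1) := by
  have hκ : 0 < |ω| := abs_pos.2 hω.ne
  rw [BirmanSchwinger.birmanSchwingerOp_eq_family]
  have hpos : ∀ μ, |ω| ≤ μ → (BirmanSchwinger.birmanSchwingerFamily hc g Ω hρ μ).IsPositive :=
    fun μ hμ ↦ BirmanSchwinger.isPositive_birmanSchwingerFamily hc g Ω hρ hΩ (hκ.trans_le hμ)
  have hcpt : ∀ μ, |ω| ≤ μ → IsCompactOperator (BirmanSchwinger.birmanSchwingerFamily hc g Ω hρ μ) :=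
    fun μ hμ ↦ BirmanSchwinger.isCompactOperator_birmanSchwingerFamily hc g Ω hρ (hκ.trans_le hμ)
  rw [BirmanSchwinger.eigenvalueCount_everywhereDefined (hpos _ le_rfl).isSymmetric]
  refine ⟨(hpos _ le_rfl).isSelfAdjoint, hcpt _ le_rfl, ?_, ?_⟩
  · have := BirmanSchwinger.finiteDimensional_spectralSubspace (hpos _ le_rfl).isSymmetric
      (hcpt _ le_rfl) one_pos (subset_refl (Set.Ici (1 : ℝ)))
    exact Module.rank_lt_aleph0 ℂ _
  · rw [BirmanSchwinger.eigenvalueCount_hamiltonian hc g Ω hρ hΩ hω]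
    exact BirmanSchwinger.sum_rank_eigenspace_one hpos hcpt
      (BirmanSchwinger.continuousOn_birmanSchwingerFamily hc g Ω hρ hΩ hκ)
      (fun μ ν hμ hν f ↦ BirmanSchwinger.re_inner_birmanSchwingerFamily_lt hc g Ω hρ hΩ
        (hκ.trans_le hμ) hν f)
      (BirmanSchwinger.exists_norm_birmanSchwingerFamily_lt_one hc g Ω hρ hΩ)
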